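/- **Setting.** For positive integers $a_1,\dots,a_n$ ($n\ge 1$) put $$M_{a_1,\dots,a_n}=\begin{pmatrix}0&1\\1&a_1\end{pmatrix}\begin{pmatrix}0&1\\1&a_2\end{pmatrix}\cdots\begin{pmatrix}0&1\\1&a_n\end{pmatrix};$$ the matrices of this form are called *reduced*. Two matrices of $\mathrm{GL}(2,\mathbb Z)$ are *$\mathrm{PGL}(2,\mathbb Z)$-conjugate* if their classes in $\mathrm{PGL}(2,\mathbb Z)=\mathrm{GL}(2,\mathbb Z)/\{\pm 1\}$ are conjugate. Let $M\in\mathrm{GL}(2,\mathbb Z)$ have real irrational eigenvalues. Its two eigenlines cut the plane into four cones. The *sail* of such a cone is the boundary of the convex hull of all nonzero integer points of the (closed) cone; it is a two-sided infinite broken line, with successive vertices $\dots,A_{-1},A_0,A_1,\dots$ (in one of the two directions). With $O$ the origin, the *LLS sequence* of this sail is the two-sided sequence of positive integers $(|a_i|)_{i\in\mathbb Z}$, where $$a_{2k}=\det(OA_k,OA_{k+1}),\qquad a_{2k-1}=\frac{\det(A_kA_{k-1},A_kA_{k+1})}{a_{2k-2}\,a_{2k}} .$$ (The LLS sequences of the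 four sails coincide up to direction and a shift of indices, and are periodic.) A finite sequence $(a_1,\dots,a_n)$ is a *period* of a two-sided sequence $s$ if $s$ is $n$-periodic and $(a_1,\dots,a_n)$ is a block of $n$ consecutive elements of $s$. The matrix $M^2$ shifts the vertices of each sail by some number $n\ge1$ of vertices; an *LLS period of $M$* is a period $(a_1,\dots,a_n)$ of exactly this length $n$ of the LLS sequence of one of the sails, written in the direction from a vertex $v$ to the vertex $M^2v$. **Theorem.** Let $M\in \mathrm{GL}(2,\mathbb Z)$ have real irrational eigenvalues, let $(a_1,\dots,a_n)$ be an LLS period of $M$, and let $m$ be the minimal length of a period of the LLS sequence of $M$. Then the reduced matrices that are $\mathrm{PGL}(2,\mathbb Z)$-conjugate to $M$ are exactly the matrices $$M_{a_{1+k},\dots,a_{n+k}},\qquad k=1,\dots,m$$ (indices modulo $n$), and these $m$ matrices are pairwise distinct. -/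

import Mathlib

open scoped Matrix MatrixGroups

namespace GaussReduction

/-! ### The matrices `M_{a_1,…,a_n}`, reduced matrices, conjugacy -/

/-- The matrix `M_{a_1,…,a_n}`: the product, in this order, of the matrices with rows
`(0, 1)` and `(1, a_k)`. -/
def contMatrix (l : List ℕ) : Matrix (Fin 2) (Fin 2) ℤ :=
  (l.map fun a : ℕ => (!![0, 1; 1, (a : ℤ)] : Matrix (Fin 2) (Fin 2) ℤ)).prod

/-- A matrix is reduced if it is `M_{a_1,…,a_n}` for some (nonempty) finite sequence of
positive integers. -/
def IsReduced (N : Matrix (Fin 2) (Fin 2) ℤ) : Prop :=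
  ∃ l : List ℕ, l ≠ [] ∧ (∀ a ∈ l, 0 < a) ∧ N = contMatrix l

/-- `PGL(2,ℤ)`-conjugacy of two `GL(2,ℤ)` matrices: their classes are conjugate in
`PGL(2,ℤ)`, the quotient of `GL(2,ℤ)` by its center `{1, -1}`. -/
def IsPGLConj (M N : GL (Fin 2) ℤ) : Prop :=
  IsConj (Matrix.ProjGenLinGroup.mk M) (Matrix.ProjGenLinGroup.mk N)

/-- The real matrix of an integer matrix, acting on the plane `Fin 2 → ℝ`. -/
def toReal (M : GL (Fin 2) ℤ) : Matrix (Fin 2) (Fin 2) ℝ :=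
  (M : Matrix (Fin 2) (Fin 2) ℤ).map (Int.cast : ℤ → ℝ)

/-- Both eigenvalues of `M` are real and irrational. -/
def HasRealIrrationalEigenvalues (M : GL (Fin 2) ℤ) : Prop :=
  ∃ x y : ℝ, Irrational x ∧ Irrational y ∧
    (toReal M).charpoly =
      (Polynomial.X - Polynomial.C x) * (Polynomial.X - Polynomial.C y)

/-! ### Angles, sails and broken lines -/

/-- The points of the plane with integer coordinates. -/
def integerPoints : Set (Fin 2 → ℝ) :=
  {p | ∀ i, ∃ z : ℤ, p i = (z : ℝ)}

/-- The closed angle (convex cone) at the origin with edges directed by `v` and `w`. -/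
def angle (v w : Fin 2 → ℝ) : Set (Fin 2 → ℝ) :=
  {p | ∃ s t : ℝ, 0 ≤ s ∧ 0 ≤ t ∧ p = s • v + t • w}

/-- The sail of an angle `C` at the origin: the boundary of the convex hull of all integer
points of `C` except the origin. -/
def sail (C : Set (Fin 2 → ℝ)) : Set (Fin 2 → ℝ) :=
  frontier (convexHull ℝ ((C ∩ integerPoints) \ {0}))

/-- The angle `C` is one of the four cones cut out by the eigenlines of `M`.  (The eigenvectors
`v`, `w` may be replaced by `-v`, `-w`, so all four cones occur.) -/
def IsConeOf (M : GL (Fin 2) ℤ) (C : Set (Fin 2 → ℝ)) : Prop :=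
  ∃ (x y : ℝ) (v w : Fin 2 → ℝ), x ≠ y ∧ v ≠ 0 ∧ w ≠ 0 ∧
    toReal M *ᵥ v = x • v ∧ toReal M *ᵥ w = y • w ∧ C = angle v w

/-- The set `S` is the two-sided infinite broken line with successive vertices
`… A (-1), A 0, A 1, …`; no vertex is superfluous. -/
def IsBrokenLine (A : ℤ → Fin 2 → ℝ) (S : Set (Fin 2 → ℝ)) : Prop :=
  (⋃ k : ℤ, segment ℝ (A k) (A (k + 1))) = S ∧
    ∀ k : ℤ, ¬ Collinear ℝ {A (k - 1), A k, A (k + 1)}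

/-- `A` is the sequence of vertices (in one of the two directions) of one of the four sails
associated to `M`. -/
def IsSailOf (M : GL (Fin 2) ℤ) (A : ℤ → Fin 2 → ℝ) : Prop :=
  ∃ C : Set (Fin 2 → ℝ), IsConeOf M C ∧ IsBrokenLine A (sail C)

/-! ### LLS sequences and LLS periods -/

/-- The determinant of a pair of vectors. -/
def det₂ (u v : Fin 2 → ℝ) : ℝ := u 0 * v 1 - u 1 * v 0

/-- The (lattice length-sine) sequence of the broken line `A`, in absolute values: with
`a (2k) = det (O A_k, O A_{k+1})` and
`a (2k-1) = det (A_k A_{k-1}, A_k A_{k+1}) / (a (2k-2) * a (2k))`,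
this is `i ↦ |a i|`. -/
noncomputable def lls (A : ℤ → Fin 2 → ℝ) (i : ℤ) : ℝ :=
  if Even i then
    |det₂ (A (i / 2)) (A (i / 2 + 1))|
  else
    let k := (i + 1) / 2
    |det₂ (A (k - 1) - A k) (A (k + 1) - A k) /
      (det₂ (A (k - 1)) (A k) * det₂ (A k) (A (k + 1)))|

/-- `s` is the LLS sequence (of positive integers) of the broken line `A`. -/
def IsLLSOf (A : ℤ → Fin 2 → ℝ) (s : ℤ → ℕ) : Prop :=
  ∀ i : ℤ, 0 < s i ∧ (s i : ℝ) = lls A i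

/-- `s` is an LLS sequence of the matrix `M`: the LLS sequence of one of its sails. -/
def IsLLSSequence (M : GL (Fin 2) ℤ) (s : ℤ → ℕ) : Prop :=
  ∃ A : ℤ → Fin 2 → ℝ, IsSailOf M A ∧ IsLLSOf A s

/-- The finite sequence `l` is a period of the two-sided sequence `s`: `s` is periodic with
period the length of `l`, and `l` is a block of consecutive elements of `s`. -/
def IsPeriodOf (l : List ℕ) (s : ℤ → ℕ) : Prop :=
  Function.Periodic s (l.length : ℤ) ∧
    ∃ j : ℤ, ∀ (i : ℕ) (hi : i < l.length), l[i] = s (j + i)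

/-- `l = (a_1,…,a_n)` is an LLS period of `M`: it is a period of the LLS sequence of a sail of
`M`, where `n` is the number of vertices by which `M ^ 2` shifts that sail, and the elements
are written in the direction from a vertex `v` to the vertex `M ^ 2 v`. -/
def IsLLSPeriod (M : GL (Fin 2) ℤ) (l : List ℕ) : Prop :=
  ∃ (A : ℤ → Fin 2 → ℝ) (s : ℤ → ℕ), IsSailOf M A ∧ IsLLSOf A s ∧
    (∀ k : ℤ, toReal (M ^ 2) *ᵥ A k = A (k + l.length)) ∧ IsPeriodOf l s

/-- `m` is the minimal length of a period of the LLS sequence of `M`. -/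
def IsMinimalLLSPeriodLength (M : GL (Fin 2) ℤ) (m : ℕ) : Prop :=
  ∃ s : ℤ → ℕ, IsLLSSequence M s ∧
    IsLeast {p : ℕ | 0 < p ∧ Function.Periodic s (p : ℤ)} m

end GaussReduction

/-!
The proof replaces sails by *chains* (`IsChain`): two-sided sequences of integer vectors with
`v (i + 2) = v i + s i • v (i + 1)`, consecutive vectors forming a basis of the lattice, such that
one eigenfunctional `f` of `M` is positive on all of them and the other one, `h`, alternates in sign.

*Sails are chains.* Each edge of a sail lies on a supporting line `α f + β h = 1` with `α, β > 0`
(`IsEigenFrame.exists_support`); positivity holds because `M ^ 2` moves the integer points of the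
angle arbitrarily close to both of its edges. A vertex is the crossing of two such lines, hence an
integer point (`IsEigenFrame.exists_int_of_two_supports`). No integer point lies between an edge and
the origin, so an edge is `s` times a vector forming a basis with its endpoint
(`IsConvexLine.exists_edge_vector`), and convexity of the turn gives the remaining coefficients. The
vertices are thus the terms of even index of a chain whose coefficients are the LLS sequence, the
terms of odd index being the directions of the edges (`IsEigenFrame.exists_chain_of_sail`).

*Chains are unique up to a shift* (`IsChain.exists_shift`), because their terms have an intrinsic
description: `q` is a term if and only if it is part of a basis `(p, q)` whose members lie on
different sides of the line `h = 0`, with `f > 0`, and which keeps this property when `p` is replaced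
by `p + q` (`IsChain.exists_eq_of_basis`). It follows that `± M` shifts its own chain, by the number
`n` of the statement, so in the basis `v i, v (i + 1)` the matrix `± M` becomes
`M_{s_i, …, s_{i + n - 1}}` (`IsChain.exists_conj`). It follows also that all sails of `M` have the
same LLS sequence up to shift and reversal.

*No other reduced matrices occur.* If `g` conjugates `± M` to a reduced matrix, the columns of the
partial products `g * M_{a_1, …, a_i}` form a chain for `M`, by the sign pattern of the eigenvectors
of positive matrices. By uniqueness it is a shift of the chain of `M`, and `(a_1, …, a_n)` is a block
of `s`; the first column of `g` determines which one (`IsEigenFrame.eq_block_of_reduced`). The last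
remark also shows that different blocks give different matrices.
-/

namespace GaussReduction

/-! ### Determinants and bases of the integer plane -/

/-- The determinant of a pair of integer vectors. -/
def intDet (p q : Fin 2 → ℤ) : ℤ := p 0 * q 1 - p 1 * q 0

lemma intDet_swap (p q : Fin 2 → ℤ) : intDet q p = -intDet p q := by
  simp only [intDet]; ring

lemma intDet_combination (p q : Fin 2 → ℤ) (α β γ δ : ℤ) :
    intDet (α • p + β • q) (γ • p + δ • q) = (α * δ - β * γ) * intDet p q := by
  simp only [intDet, Pi.add_apply, Pi.smul_apply, smul_eq_mul]; ring

lemma intDet_neg_neg (p q : Fin 2 → ℤ) : intDet (-p) (-q) = intDet p q := by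
  simp only [intDet, Pi.neg_apply]; ring

lemma intDet_smul_smul (ε : ℤˣ) (p q : Fin 2 → ℤ) : intDet (ε • p) (ε • q) = intDet p q := by
  rcases Int.units_eq_one_or ε with rfl | rfl
  · simp
  · simpa using intDet_neg_neg p q

lemma exists_combination {p q : Fin 2 → ℤ} (h : IsUnit (intDet p q)) (r : Fin 2 → ℤ) :
    ∃ α β : ℤ, r = α • p + β • q := by
  refine ⟨intDet p q * intDet r q, intDet p q * intDet p r, ?_⟩
  have h2 : intDet p q * intDet p q = 1 := Int.isUnit_mul_self h
  have key : intDet p q • r = intDet r q • p + intDet p r • q := by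
    ext i
    fin_cases i <;> simp [intDet] <;> ring
  calc r = (intDet p q * intDet p q) • r := by rw [h2, one_smul]
    _ = _ := by rw [mul_smul, key, smul_add, smul_smul, smul_smul]

/-! ### Chains -/

/-- A chain for a pair of functionals `f`, `h` on the integer plane, with coefficients `s`: a
two-sided sequence of integer vectors with `v (i + 2) = v i + s i • v (i + 1)`, in which
neighbours form a basis of the lattice, `f` is positive, and `h` alternates in sign.  The terms of
even index and those of odd index lie in two adjacent angles bounded by the lines `f = 0` and
`h = 0`. -/
structure IsChain (f h : (Fin 2 → ℤ) →+ ℝ) (v : ℤ → Fin 2 → ℤ) (s : ℤ → ℕ) : Prop where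
  pos : ∀ i, 0 < s i
  add_two : ∀ i, v (i + 2) = v i + (s i : ℤ) • v (i + 1)
  isUnit_intDet : ∀ i, IsUnit (intDet (v i) (v (i + 1)))
  f_pos : ∀ i, 0 < f (v i)
  h_alt : ∀ i, h (v i) * h (v (i + 1)) < 0

namespace IsChain

variable {f h : (Fin 2 → ℤ) →+ ℝ} {v w : ℤ → Fin 2 → ℤ} {s t : ℤ → ℕ}

lemma one_le (c : IsChain f h v s) (i : ℤ) : (1 : ℝ) ≤ s i := by exact_mod_cast c.pos i

lemma f_add_two (c : IsChain f h v s) (i : ℤ) :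
    f (v (i + 2)) = f (v i) + s i * f (v (i + 1)) := by
  rw [c.add_two i, map_add, map_zsmul, zsmul_eq_mul]; simp

lemma h_add_two (c : IsChain f h v s) (i : ℤ) :
    h (v (i + 2)) = h (v i) + s i * h (v (i + 1)) := by
  rw [c.add_two i, map_add, map_zsmul, zsmul_eq_mul]; simp

lemma add_le_f_add_two (c : IsChain f h v s) (i : ℤ) :
    f (v i) + f (v (i + 1)) ≤ f (v (i + 2)) := by
  rw [c.f_add_two]
  nlinarith [c.one_le i, c.f_pos (i + 1)]

lemma strictMono_f (c : IsChain f h v s) : StrictMono fun i => f (v i) := by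
  refine strictMono_int_of_lt_succ fun i => ?_
  have h1 := c.add_le_f_add_two (i - 1)
  have h2 := c.f_pos (i - 1)
  rw [show i - 1 + 1 = i by ring, show i - 1 + 2 = i + 1 by ring] at h1
  linarith

lemma two_mul_f_le (c : IsChain f h v s) (i : ℤ) : 2 * f (v i) ≤ f (v (i + 2)) := by
  have h1 := c.add_le_f_add_two i
  have h2 := c.strictMono_f (show i < i + 1 by lia)
  simp only at h2
  linarith

lemma pow_mul_f_le (c : IsChain f h v s) (i : ℤ) (k : ℕ) :
    2 ^ k * f (v i) ≤ f (v (i + 2 * k)) := by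
  induction k with
  | zero => simp
  | succ k ih =>
    have := c.two_mul_f_le (i + 2 * k)
    rw [show i + 2 * ((k + 1 : ℕ) : ℤ) = i + 2 * k + 2 by push_cast; ring, pow_succ]
    linarith

/-- The values of `f` along a chain tend to `0` and to `∞` at the two ends, so every positive
number lies between two neighbouring values. -/
lemma exists_f_le_lt (c : IsChain f h v s) {b : ℝ} (hb : 0 < b) :
    ∃ k, f (v k) ≤ b ∧ b < f (v (k + 1)) := by
  have hbdd : ∃ B : ℤ, ∀ k : ℤ, f (v k) ≤ b → k ≤ B := by
    obtain ⟨m, hm⟩ := pow_unbounded_of_one_lt (b / f (v 0)) (one_lt_two (α := ℝ))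
    refine ⟨2 * m, fun k hk => ?_⟩
    by_contra! hlt
    have h1 := c.strictMono_f hlt
    have h2 := c.pow_mul_f_le 0 m
    rw [div_lt_iff₀ (c.f_pos 0)] at hm
    rw [zero_add] at h2
    simp only at h1
    linarith
  have hne : ∃ k : ℤ, f (v k) ≤ b := by
    obtain ⟨m, hm⟩ := pow_unbounded_of_one_lt (f (v 0) / b) (one_lt_two (α := ℝ))
    refine ⟨-(2 * m), ?_⟩
    have h2 := c.pow_mul_f_le (-(2 * m)) m
    rw [show -(2 * (m : ℤ)) + 2 * m = 0 by ring] at h2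
    rw [div_lt_iff₀ hb] at hm
    have : (2 : ℝ) ^ m * f (v (-(2 * m))) ≤ 2 ^ m * b := by linarith
    exact le_of_mul_le_mul_left this (by positivity)
  obtain ⟨k, hk, hmax⟩ := Int.exists_greatest_of_bdd hbdd hne
  refine ⟨k, hk, ?_⟩
  by_contra! hle
  have := hmax _ hle
  lia

/-- The sum of two neighbours lies in the same angle as the first of them, because `v i` and
`v (i + 2) = v i + s i • v (i + 1)` both lie there. -/
lemma h_add_mul_neg (c : IsChain f h v s) (i : ℤ) :
    h (v i + v (i + 1)) * h (v (i + 1)) < 0 := by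
  have h1 := c.h_alt (i + 1)
  rw [show i + 1 + 1 = i + 2 by ring, c.h_add_two] at h1
  rw [map_add]
  nlinarith [c.one_le i, mul_self_nonneg (h (v (i + 1)))]

end IsChain

/-- Two bases whose first members lie in one angle and whose second members lie in the adjacent
one are comparable: the matrix expressing one through the other has determinant `1`, positive
diagonal, and off-diagonal entries of the same sign. -/
lemma basis_comparison {f₁ f₂ h₁ h₂ : ℝ} {α β γ δ : ℤ} (hf₁ : 0 < f₁) (hf₂ : 0 < f₂)
    (hh : h₁ * h₂ < 0) (hdet : IsUnit (α * δ - β * γ))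
    (hf : 0 < α * f₁ + β * f₂) (hf' : 0 < γ * f₁ + δ * f₂)
    (hh₁ : 0 < (α * h₁ + β * h₂) * h₁) (hh₂ : 0 < (γ * h₁ + δ * h₂) * h₂) :
    1 ≤ α ∧ 1 ≤ δ ∧ α * δ - β * γ = 1 ∧ (0 ≤ β ∧ 0 ≤ γ ∨ β ≤ 0 ∧ γ ≤ 0) := by
  wlog hpos : 0 < h₁ generalizing h₁ h₂
  · have h0 : h₁ ≠ 0 := by rintro rfl; simp at hh
    have hneg : h₁ < 0 := lt_of_le_of_ne (not_lt.mp hpos) h0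
    exact this (h₁ := -h₁) (h₂ := -h₂) (by linarith) (by linarith) (by linarith) (by linarith)
  have hneg : h₂ < 0 := by nlinarith
  have e₁ : 0 < α * h₁ + β * h₂ := by
    rcases pos_and_pos_or_neg_and_neg_of_mul_pos hh₁ with h | h <;> linarith [h.1, h.2]
  have e₂ : γ * h₁ + δ * h₂ < 0 := by
    rcases pos_and_pos_or_neg_and_neg_of_mul_pos hh₂ with h | h <;> linarith [h.1, h.2]
  have hα : 1 ≤ α := by
    by_contra! hlt
    have hα0 : (α : ℝ) ≤ 0 := by exact_mod_cast Int.lt_add_one_iff.mp hlt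
    have hβ : 0 < (β : ℝ) := by
      by_contra! hb
      nlinarith
    nlinarith
  have hδ : 1 ≤ δ := by
    by_contra! hlt
    have hδ0 : (δ : ℝ) ≤ 0 := by exact_mod_cast Int.lt_add_one_iff.mp hlt
    have hγ : 0 < (γ : ℝ) := by
      by_contra! hb
      nlinarith
    nlinarith
  have hα' : (1 : ℝ) ≤ α := by exact_mod_cast hα
  have hδ' : (1 : ℝ) ≤ δ := by exact_mod_cast hδ
  have hdetpos : 0 < α * δ - β * γ := by
    rcases le_or_gt (β * γ) 0 with hle | hgt
    · nlinarith
    · rcases pos_and_pos_or_neg_and_neg_of_mul_pos hgt with ⟨hb, hg⟩ | ⟨hb, hg⟩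
      · have hb' : (0 : ℝ) < β := by exact_mod_cast hb
        have hg' : (0 : ℝ) < γ := by exact_mod_cast hg
        have k1 : β * (-h₂) < α * h₁ := by linarith
        have k2 : γ * h₁ < δ * (-h₂) := by linarith
        have k3 : (β * (-h₂)) * (γ * h₁) < (α * h₁) * (δ * (-h₂)) :=
          mul_lt_mul'' k1 k2 (by nlinarith) (by positivity)
        have k4 : (β * γ : ℝ) < α * δ := by
          have : 0 < h₁ * (-h₂) := mul_pos hpos (by linarith)
          by_contra! hc
          nlinarith
        have : β * γ < α * δ := by exact_mod_cast k4
        linarith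
      · have hb' : (β : ℝ) < 0 := by exact_mod_cast hb
        have hg' : (γ : ℝ) < 0 := by exact_mod_cast hg
        have k1 : -β * f₂ < α * f₁ := by linarith
        have k2 : -γ * f₁ < δ * f₂ := by linarith
        have k3 : (-β * f₂) * (-γ * f₁) < (α * f₁) * (δ * f₂) :=
          mul_lt_mul'' k1 k2 (by nlinarith) (by nlinarith)
        have k4 : (β * γ : ℝ) < α * δ := by
          have : 0 < f₁ * f₂ := mul_pos hf₁ hf₂
          by_contra! hc
          nlinarith
        have : β * γ < α * δ := by exact_mod_cast k4
        linarith
  have hone : α * δ - β * γ = 1 := by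
    rcases Int.isUnit_iff.mp hdet with h | h <;> lia
  refine ⟨hα, hδ, hone, ?_⟩
  have hnn : 0 ≤ β * γ := by nlinarith
  exact mul_nonneg_iff.mp hnn

namespace IsChain

variable {f h : (Fin 2 → ℤ) →+ ℝ} {v w : ℤ → Fin 2 → ℤ} {s t : ℤ → ℕ}

/-- An intrinsic description of the terms of a chain: they are the vectors `q` that remain part of
a basis with members in two adjacent angles when the other member `p` is replaced by `p + q`. -/
lemma exists_eq_of_basis (c : IsChain f h v s) {p q : Fin 2 → ℤ} (hu : IsUnit (intDet p q))
    (hp : 0 < f p) (hq : 0 < f q) (hh : h p * h q < 0) (hh' : h (p + q) * h q < 0) :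
    ∃ k, q = v k := by
  obtain ⟨k, hk, hk'⟩ := c.exists_f_le_lt hq
  have hf₁ := c.f_pos k
  have hf₂ := c.f_pos (k + 1)
  have hv := c.h_alt k
  have hval : ∀ (g : (Fin 2 → ℤ) →+ ℝ) (a b : ℤ),
      g (a • v k + b • v (k + 1)) = a * g (v k) + b * g (v (k + 1)) := fun g a b => by
    rw [map_add, map_zsmul, map_zsmul, zsmul_eq_mul, zsmul_eq_mul]
  obtain ⟨a, b, hqe⟩ := exists_combination (c.isUnit_intDet k) q
  obtain ⟨a', b', hpe⟩ := exists_combination (c.isUnit_intDet k) p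
  rw [map_add] at hh'
  have hsplit : 0 < h q * h (v k) ∨ 0 < h q * h (v (k + 1)) := by
    have hq0 : h q ≠ 0 := by intro h0; rw [h0] at hh; simp at hh
    rcases lt_or_gt_of_ne hq0 with h1 | h1 <;> rcases mul_neg_iff.mp hv with ⟨h2, h3⟩ | ⟨h2, h3⟩
    · exact Or.inr (mul_pos_of_neg_of_neg h1 h3)
    · exact Or.inl (mul_pos_of_neg_of_neg h1 h2)
    · exact Or.inl (mul_pos h1 h2)
    · exact Or.inr (mul_pos h1 h3)
  have opp : ∀ {r r' y z : ℝ}, r * r' < 0 → y * z < 0 → 0 < r' * y → 0 < r * z := by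
    intro r r' y z h1 h2 h3
    rcases mul_neg_iff.mp h1 with ⟨h4, h5⟩ | ⟨h4, h5⟩ <;>
      rcases mul_neg_iff.mp h2 with ⟨h6, h7⟩ | ⟨h6, h7⟩ <;> nlinarith
  rcases hsplit with hs | hs
  · have hp' := opp hh hv hs
    have hdet : IsUnit (a * b' - b * a') := by
      have : IsUnit (intDet q p) := by rw [intDet_swap]; exact hu.neg
      rw [hqe, hpe, intDet_combination] at this
      exact isUnit_of_mul_isUnit_left this
    rw [hpe, hval] at hp hp'
    rw [hqe, hval] at hq hs hk hk'
    obtain ⟨ha, hb', hone, hsign⟩ := basis_comparison hf₁ hf₂ hv hdet hq hp hs hp'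
    have ha' : (1 : ℝ) ≤ a := by exact_mod_cast ha
    have hb1 : (1 : ℝ) ≤ b' := by exact_mod_cast hb'
    have hb : b = 0 := by
      rcases lt_trichotomy b 0 with hlt | h0 | hgt
      · exfalso
        -- Now `v k = b' • q - b • p`, so that `f (v k) > f q`.
        have hbr : (b : ℝ) ≤ -1 := by exact_mod_cast Int.le_sub_one_of_lt hlt
        have honeR : (a * b' - b * a' : ℝ) = 1 := by exact_mod_cast hone
        have e : f (v k) = b' * (a * f (v k) + b * f (v (k + 1)))
            - b * (a' * f (v k) + b' * f (v (k + 1))) := by linear_combination -f (v k) * honeR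
        nlinarith
      · exact h0
      · exfalso
        have hbr : (1 : ℝ) ≤ b := by exact_mod_cast hgt
        nlinarith
    have ha1 : a = 1 := by
      subst hb
      simp only [zero_mul, sub_zero] at hone
      exact Int.eq_one_of_mul_eq_one_right (by lia) hone
    exact ⟨k, by rw [hqe, ha1, hb]; simp⟩
  · have hv' : h (v (k + 1)) * h (v k) < 0 := by linarith
    have hp' := opp hh hv' hs
    have hpq' := opp hh' hv' hs
    have hdet : IsUnit (a' * b - b' * a) := by
      rw [hqe, hpe, intDet_combination] at hu
      exact isUnit_of_mul_isUnit_left hu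
    have hdet' : IsUnit ((a' + a) * b - (b' + b) * a) := by
      rwa [show (a' + a) * b - (b' + b) * a = a' * b - b' * a by ring]
    have hpq : 0 < f p + f q := by linarith
    rw [hpe, hqe, hval, hval] at hpq hpq'
    rw [hpe, hval] at hp hp'
    rw [hqe, hval] at hq hs hk hk'
    obtain ⟨ha', hb, hone, hsign⟩ := basis_comparison hf₁ hf₂ hv hdet hp hq hp' hs
    obtain ⟨ha2, -, -, -⟩ := basis_comparison (α := a' + a) (β := b' + b) hf₁ hf₂ hv hdet'
      (by push_cast; linarith) hq (by push_cast; linarith) hs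
    have hbr : (1 : ℝ) ≤ b := by exact_mod_cast hb
    have ha : a < 0 := by
      by_contra! h0
      have : (0 : ℝ) ≤ a := by exact_mod_cast h0
      nlinarith
    have hb0 : b' = 0 := by
      by_contra h0
      have hlt : b' ≤ -1 := by lia
      have hltR : (b' : ℝ) ≤ -1 := by exact_mod_cast hlt
      have honeR : (a' * b - b' * a : ℝ) = 1 := by exact_mod_cast hone
      have e : f (v k) = b * (a' * f (v k) + b' * f (v (k + 1)))
          - b' * (a * f (v k) + b * f (v (k + 1))) := by linear_combination -f (v k) * honeR
      nlinarith
    exfalso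
    subst hb0
    simp only [zero_mul, sub_zero] at hone
    have := Int.eq_one_of_mul_eq_one_right (by lia) hone
    lia

/-- The functionals `f` and `h` determine the set of terms of a chain. -/
lemma exists_eq (c : IsChain f h v s) (d : IsChain f h w t) (i : ℤ) : ∃ k, w i = v k := by
  have e : i - 1 + 1 = i := by ring
  have h1 := d.isUnit_intDet (i - 1)
  have h2 := d.h_alt (i - 1)
  have h3 := d.h_add_mul_neg (i - 1)
  rw [e] at h1 h2 h3
  exact c.exists_eq_of_basis h1 (d.f_pos _) (d.f_pos _) h2 h3

lemma ne_zero (c : IsChain f h v s) (i : ℤ) : v i ≠ 0 := by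
  intro h0
  have := c.f_pos i
  rw [h0, map_zero] at this
  exact lt_irrefl _ this

/-- A chain is determined by its functionals, up to a shift of the indices. -/
theorem exists_shift (c : IsChain f h v s) (d : IsChain f h w t) :
    ∃ j : ℤ, (∀ i, w i = v (i + j)) ∧ ∀ i, t i = s (i + j) := by
  choose σ hσ using c.exists_eq d
  have hmono : StrictMono σ := fun a b hab => by
    have := d.strictMono_f hab
    simp only [hσ] at this
    exact c.strictMono_f.lt_iff_lt.mp this
  have hsurj : Function.Surjective σ := fun k => by
    obtain ⟨i, hi⟩ := d.exists_eq c k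
    refine ⟨i, c.strictMono_f.injective ?_⟩
    simp only [← hσ, hi]
  have hsucc : ∀ i, σ (i + 1) = σ i + 1 := fun i => by
    obtain ⟨k, hk⟩ := hsurj (σ i + 1)
    have h1 : i < k := hmono.lt_iff_lt.mp (by lia)
    have h2 : k < i + 2 := by
      by_contra! hle
      have h3 := hmono (show i < i + 1 by lia)
      have h4 := hmono (show i + 1 < i + 2 by lia)
      have h5 := hmono.monotone hle
      lia
    rw [← hk, show k = i + 1 by lia]
  have hall : ∀ i, σ i = i + σ 0 := fun i => by
    induction i using Int.induction_on with
    | zero => simp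
    | succ n ih => rw [hsucc, ih]; ring
    | pred n ih => have := hsucc (-n - 1); rw [sub_add_cancel] at this; lia
  have hw : ∀ i, w i = v (i + σ 0) := fun i => by rw [hσ, hall]
  refine ⟨σ 0, hw, fun i => ?_⟩
  have h1 := d.add_two i
  have h2 := c.add_two (i + σ 0)
  rw [hw, hw, hw, show i + 2 + σ 0 = i + σ 0 + 2 by ring, h2,
    show i + 1 + σ 0 = i + σ 0 + 1 by ring, add_right_inj] at h1
  have h3 := smul_left_injective ℤ (c.ne_zero (i + σ 0 + 1)) h1
  lia

/-- Read backwards, with every other term negated, a chain is a chain for the exchanged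
functionals. -/
lemma reverse (c : IsChain h f v s) (h0 : 0 < f (v 0)) :
    IsChain f h (fun i => ((-1 : ℤˣ) ^ i) • v (-i)) (fun i => s (-i - 2)) where
  pos i := c.pos _
  add_two i := by
    have h1 := c.add_two (-i - 2)
    rw [show -i - 2 + 2 = -i by ring, show -i - 2 + 1 = -(i + 1) by ring,
      show -i - 2 = -(i + 2) by ring] at h1
    simp only [h1, zpow_add, show -i - 2 = -(i + 2) by ring]
    rcases Int.even_or_odd i with hi | hi <;> simp [hi.neg_one_zpow]
  isUnit_intDet i := by
    have h1 := c.isUnit_intDet (-(i + 1))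
    rw [show -(i + 1) + 1 = -i by ring] at h1
    rw [zpow_add, zpow_one, mul_neg_one, Units.neg_smul]
    have h2 : intDet (((-1 : ℤˣ) ^ i) • v (-i)) (-(((-1 : ℤˣ) ^ i) • v (-(i + 1)))) =
        intDet (v (-(i + 1))) (v (-i)) := by
      rw [← intDet_smul_smul ((-1 : ℤˣ) ^ i) (v (-(i + 1)))]
      simp only [intDet, Pi.neg_apply]; ring
    rw [h2]; exact h1
  f_pos i := by
    have hstep : ∀ i : ℤ, 0 < f (((-1 : ℤˣ) ^ i) • v (-i)) ↔
        0 < f (((-1 : ℤˣ) ^ (i + 1)) • v (-(i + 1))) := fun i => by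
      have h1 := c.h_alt (-(i + 1))
      rw [show -(i + 1) + 1 = -i by ring] at h1
      rw [zpow_add, zpow_one, mul_neg_one, Units.neg_smul, map_neg]
      generalize v (-(i + 1)) = q at h1 ⊢
      rcases mul_neg_iff.mp h1 with ⟨h2, h3⟩ | ⟨h2, h3⟩ <;>
      rcases Int.even_or_odd i with hi | hi <;> simp [hi.neg_one_zpow] <;>
        constructor <;> intro <;> linarith
    induction i using Int.induction_on with
    | zero => simpa using h0
    | succ n ih => exact (hstep _).mp ih
    | pred n ih => have := hstep (-n - 1); rw [sub_add_cancel] at this; exact this.mpr ih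
  h_alt i := by
    have h1 := mul_pos (c.f_pos (-i)) (c.f_pos (-(i + 1)))
    rw [zpow_add, zpow_one, mul_neg_one, Units.neg_smul, map_neg]
    generalize v (-(i + 1)) = q at h1 ⊢
    rcases Int.even_or_odd i with hi | hi <;> simp [hi.neg_one_zpow] <;> linarith

lemma neg_left (c : IsChain f h v s) : IsChain (-f) h (fun i => -v i) s where
  pos := c.pos
  add_two i := by simp only [c.add_two i, smul_neg]; abel
  isUnit_intDet i := by rw [intDet_neg_neg]; exact c.isUnit_intDet i
  f_pos i := by simpa using c.f_pos i
  h_alt i := by simpa using c.h_alt i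

lemma neg_right (c : IsChain f h v s) : IsChain f (-h) v s :=
  ⟨c.pos, c.add_two, c.isUnit_intDet, c.f_pos, fun i => by simpa using c.h_alt i⟩

lemma exists_reverse (c : IsChain h f v s) : ∃ w, IsChain f h w fun i => s (-i - 2) := by
  rcases lt_or_ge 0 (f (v 0)) with h0 | h0
  · exact ⟨_, c.reverse h0⟩
  · have h1 : f (v 0) ≠ 0 := left_ne_zero_of_mul (c.h_alt 0).ne
    have h2 : 0 < (-f) (v 0) := by
      simpa using lt_of_le_of_ne h0 h1
    have := (c.neg_right.reverse h2).neg_left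
    rw [neg_neg] at this
    exact ⟨_, this⟩

end IsChain

/-! ### Products of elementary matrices along a chain -/

/-- The block of `n` consecutive terms of `s` that starts at the index `i`. -/
def block (s : ℤ → ℕ) (i : ℤ) (n : ℕ) : List ℕ := (List.range n).map fun r : ℕ => s (i + r)

@[simp] lemma length_block (s : ℤ → ℕ) (i : ℤ) (n : ℕ) : (block s i n).length = n := by
  simp [block]

lemma block_succ (s : ℤ → ℕ) (i : ℤ) (n : ℕ) : block s i (n + 1) = block s i n ++ [s (i + n)] := by
  simp [block, List.range_succ]

lemma getElem_block (s : ℤ → ℕ) (i : ℤ) (n r : ℕ) (hr : r < (block s i n).length) :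
    (block s i n)[r] = s (i + r) := by
  simp [block]

lemma eq_block_iff {l : List ℕ} {s : ℤ → ℕ} {j : ℤ} :
    l = block s j l.length ↔ ∀ (i : ℕ) (hi : i < l.length), l[i] = s (j + i) := by
  constructor
  · intro h i hi
    have := getElem_block s j l.length i (by simpa using hi)
    rw [← this]
    congr 1
  · intro h
    refine List.ext_getElem (by simp) fun i hi hi' => ?_
    rw [h i hi, getElem_block]

lemma rotate_block {s : ℤ → ℕ} {n : ℕ} (hs : Function.Periodic s (n : ℤ)) (i : ℤ) (k : ℕ) :
    (block s i n).rotate k = block s (i + k) n := by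
  refine List.ext_getElem (by simp) fun r hr hr' => ?_
  rw [List.getElem_rotate, getElem_block, getElem_block, length_block]
  have h1 := Int.mul_ediv_add_emod ((r + k : ℕ) : ℤ) n
  have h2 := hs.int_mul (((r + k : ℕ) : ℤ) / n) (i + (((r + k) % n : ℕ) : ℤ))
  rw [← h2]
  congr 1
  simp only [Int.cast_id]
  push_cast at h1 ⊢
  linarith

lemma contMatrix_append (l l' : List ℕ) :
    contMatrix (l ++ l') = contMatrix l * contMatrix l' := by
  simp [contMatrix]

/-- The factor `(0, 1; 1, a)` as an invertible matrix. -/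
def elemGL (a : ℕ) : GL (Fin 2) ℤ where
  val := !![0, 1; 1, (a : ℤ)]
  inv := !![-(a : ℤ), 1; 1, 0]
  val_inv := by ext i j; fin_cases i <;> fin_cases j <;> simp
  inv_val := by ext i j; fin_cases i <;> fin_cases j <;> simp

lemma contMatrix_singleton (a : ℕ) :
    contMatrix [a] = (elemGL a : Matrix (Fin 2) (Fin 2) ℤ) := by
  simp [contMatrix, elemGL]

lemma eq_mul_contMatrix_block {P : ℤ → Matrix (Fin 2) (Fin 2) ℤ} {s : ℤ → ℕ}
    (hP : ∀ i, P (i + 1) = P i * (elemGL (s i)).val) (i : ℤ) (n : ℕ) :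
    P (i + n) = P i * contMatrix (block s i n) := by
  induction n with
  | zero => simp [block, contMatrix]
  | succ n ih =>
    rw [block_succ, contMatrix_append, contMatrix_singleton, ← mul_assoc, ← ih, ← hP]
    congr 1
    push_cast; ring

/-- The matrix with the columns `p` and `q`. -/
def colMatrix (p q : Fin 2 → ℤ) : Matrix (Fin 2) (Fin 2) ℤ := !![p 0, q 0; p 1, q 1]

lemma det_colMatrix (p q : Fin 2 → ℤ) : (colMatrix p q).det = intDet p q := by
  simp [colMatrix, intDet, Matrix.det_fin_two_of, mul_comm]

lemma colMatrix_mul (p q : Fin 2 → ℤ) (N : Matrix (Fin 2) (Fin 2) ℤ) :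
    colMatrix p q * N = colMatrix (N 0 0 • p + N 1 0 • q) (N 0 1 • p + N 1 1 • q) := by
  ext i j
  fin_cases i <;> fin_cases j <;> simp [colMatrix, Matrix.mul_apply, Fin.sum_univ_two] <;> ring

lemma mul_colMatrix (N : Matrix (Fin 2) (Fin 2) ℤ) (p q : Fin 2 → ℤ) :
    N * colMatrix p q = colMatrix (N *ᵥ p) (N *ᵥ q) := by
  ext i j
  fin_cases i <;> fin_cases j <;>
    simp [colMatrix, Matrix.mul_apply, Fin.sum_univ_two, Matrix.mulVec, dotProduct]

lemma colMatrix_inj {p q p' q' : Fin 2 → ℤ} (h : colMatrix p q = colMatrix p' q') :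
    p = p' ∧ q = q' := by
  have h00 := congrFun₂ h 0 0
  have h01 := congrFun₂ h 0 1
  have h10 := congrFun₂ h 1 0
  have h11 := congrFun₂ h 1 1
  simp [colMatrix] at h00 h01 h10 h11
  constructor <;> ext i <;> fin_cases i <;> assumption

lemma unit_smul_colMatrix (ε : ℤˣ) (p q : Fin 2 → ℤ) :
    ε • colMatrix p q = colMatrix (ε • p) (ε • q) := by
  ext i j
  fin_cases i <;> fin_cases j <;> simp [colMatrix]

lemma IsChain.colMatrix_succ {f h : (Fin 2 → ℤ) →+ ℝ} {v : ℤ → Fin 2 → ℤ} {s : ℤ → ℕ}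
    (c : IsChain f h v s) (i : ℤ) :
    colMatrix (v (i + 1)) (v (i + 1 + 1)) = colMatrix (v i) (v (i + 1)) * (elemGL (s i)).val := by
  rw [colMatrix_mul, show i + 1 + 1 = i + 2 by ring, c.add_two]
  simp [elemGL]

lemma contMatrix_entries {l : List ℕ} (hl : l ≠ []) (hpos : ∀ a ∈ l, 0 < a) :
    0 ≤ contMatrix l 0 0 ∧ 0 < contMatrix l 0 1 ∧ 0 < contMatrix l 1 0 ∧ 0 < contMatrix l 1 1 := by
  induction l with
  | nil => exact absurd rfl hl
  | cons a l ih =>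
    have ha : (0 : ℤ) < a := by exact_mod_cast hpos a (by simp)
    rw [← List.singleton_append, contMatrix_append, contMatrix_singleton]
    rcases eq_or_ne l [] with rfl | hne
    · simpa [contMatrix, elemGL] using ha
    · obtain ⟨h1, h2, h3, h4⟩ := ih hne fun b hb => hpos b (by simp [hb])
      simp only [elemGL, Matrix.mul_apply, Fin.sum_univ_two, Matrix.of_apply, Matrix.cons_val',
        Matrix.cons_val_zero, Matrix.cons_val_one, Matrix.cons_val_fin_one, zero_mul, one_mul,
        zero_add]
      refine ⟨h3.le, h4, ?_, ?_⟩ <;> positivity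

/-! ### Eigenfunctionals -/

/-- The inclusion of the integer points in the plane. -/
def castVec : (Fin 2 → ℤ) →+ (Fin 2 → ℝ) := (Int.castAddHom ℝ).compLeft (Fin 2)

@[simp] lemma castVec_apply (p : Fin 2 → ℤ) (i : Fin 2) : castVec p i = (p i : ℝ) := rfl

lemma castVec_injective : Function.Injective castVec := fun p q h => by
  ext i
  have := congrFun h i
  simpa using this

lemma toReal_mulVec_castVec (M : GL (Fin 2) ℤ) (p : Fin 2 → ℤ) :
    toReal M *ᵥ castVec p = castVec (M.val *ᵥ p) := by
  ext i
  fin_cases i <;> simp [toReal, Matrix.mulVec, dotProduct]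

/-- The restriction of a linear functional on the plane to the integer points. -/
def onInt (f : (Fin 2 → ℝ) →ₗ[ℝ] ℝ) : (Fin 2 → ℤ) →+ ℝ := f.toAddMonoidHom.comp castVec

lemma onInt_apply (f : (Fin 2 → ℝ) →ₗ[ℝ] ℝ) (p : Fin 2 → ℤ) : onInt f p = f (castVec p) := rfl

/-- Linear coordinates `f`, `h` of the plane that are eigenvectors of the transpose of `M`, for
irrational eigenvalues `x` and `y`.  The eigenlines of `M` are the lines `f = 0` and `h = 0`. -/
structure IsEigenFrame (M : GL (Fin 2) ℤ) (f h : (Fin 2 → ℝ) →ₗ[ℝ] ℝ) (x y : ℝ) : Prop where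
  f_mulVec : ∀ p, f (toReal M *ᵥ p) = x * f p
  h_mulVec : ∀ p, h (toReal M *ᵥ p) = y * h p
  eq_zero : ∀ p, f p = 0 → h p = 0 → p = 0
  irrational_left : Irrational x
  irrational_right : Irrational y
  mul_sq : (x * y) ^ 2 = 1

namespace IsEigenFrame

variable {M : GL (Fin 2) ℤ} {f h : (Fin 2 → ℝ) →ₗ[ℝ] ℝ} {x y : ℝ}

lemma swap (F : IsEigenFrame M f h x y) : IsEigenFrame M h f y x :=
  ⟨F.h_mulVec, F.f_mulVec, fun p h1 h2 => F.eq_zero p h2 h1, F.irrational_right, F.irrational_left,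
    by rw [mul_comm]; exact F.mul_sq⟩

lemma smul (F : IsEigenFrame M f h x y) {a b : ℝ} (ha : a ≠ 0) (hb : b ≠ 0) :
    IsEigenFrame M (a • f) (b • h) x y where
  f_mulVec p := by simp only [LinearMap.smul_apply, F.f_mulVec, smul_eq_mul]; ring
  h_mulVec p := by simp only [LinearMap.smul_apply, F.h_mulVec, smul_eq_mul]; ring
  eq_zero p h1 h2 := F.eq_zero p (by simpa [ha] using h1) (by simpa [hb] using h2)
  irrational_left := F.irrational_left
  irrational_right := F.irrational_right
  mul_sq := F.mul_sq

lemma onInt_mulVec (F : IsEigenFrame M f h x y) (p : Fin 2 → ℤ) :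
    onInt f (M.val *ᵥ p) = x * onInt f p := by
  rw [onInt_apply, ← toReal_mulVec_castVec, F.f_mulVec, onInt_apply]

/-- An eigenline for an irrational eigenvalue contains no nonzero integer point. -/
lemma onInt_ne_zero (F : IsEigenFrame M f h x y) {p : Fin 2 → ℤ} (hp : p ≠ 0) :
    onInt f p ≠ 0 := by
  intro h0
  rw [onInt_apply] at h0
  have h1 : toReal M *ᵥ castVec p - y • castVec p = 0 := by
    refine F.eq_zero _ ?_ ?_
    · rw [map_sub, F.f_mulVec, map_smul, h0]; simp
    · rw [map_sub, F.h_mulVec, map_smul]; simp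
  obtain ⟨i, hi⟩ := Function.ne_iff.mp hp
  have h2 := congrFun h1 i
  rw [toReal_mulVec_castVec] at h2
  simp only [Pi.sub_apply, castVec_apply, Pi.smul_apply, smul_eq_mul, Pi.zero_apply] at h2
  have hi' : (p i : ℝ) ≠ 0 := by exact_mod_cast hi
  refine F.irrational_right ⟨((M.val *ᵥ p) i : ℚ) / (p i : ℚ), ?_⟩
  push_cast
  field_simp
  linarith

lemma x_ne_zero (F : IsEigenFrame M f h x y) : x ≠ 0 := F.irrational_left.ne_zero

/-- The matrix `M`, up to sign, shifts every chain for its eigenfunctionals. -/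
lemma exists_shift (F : IsEigenFrame M f h x y) {v : ℤ → Fin 2 → ℤ} {s : ℤ → ℕ}
    (c : IsChain (onInt f) (onInt h) v s) :
    ∃ (ε : ℤˣ) (j : ℤ), (∀ i, M.val *ᵥ v i = ε • v (i + j)) ∧ ∀ i, s i = s (i + j) := by
  obtain ⟨ε, hε⟩ : ∃ ε : ℤˣ, 0 < ((ε : ℤ) : ℝ) * x := by
    rcases lt_or_gt_of_ne F.x_ne_zero with h1 | h1
    · exact ⟨-1, by simpa using h1⟩
    · exact ⟨1, by simpa using h1⟩
  have hε2 : ((ε : ℤ) : ℝ) * ((ε : ℤ) : ℝ) = 1 := by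
    rw [← Int.cast_mul]; exact_mod_cast Int.isUnit_mul_self ε.isUnit
  have hval : ∀ {f h x y} (_ : IsEigenFrame M f h x y) (p : Fin 2 → ℤ),
      onInt f (ε • (M.val *ᵥ p)) = (ε : ℤ) * x * onInt f p := fun F p => by
    rw [Units.smul_def, map_zsmul, F.onInt_mulVec, zsmul_eq_mul]; ring
  have hMdet : IsUnit M.val.det := (Matrix.isUnit_iff_isUnit_det _).mp M.isUnit
  have d : IsChain (onInt f) (onInt h) (fun i => ε • (M.val *ᵥ v i)) s := by
    refine ⟨c.pos, fun i => ?_, fun i => ?_, fun i => ?_, fun i => ?_⟩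
    · rw [c.add_two, Matrix.mulVec_add, Matrix.mulVec_smul, smul_add, smul_comm]
    · rw [intDet_smul_smul, ← det_colMatrix, ← mul_colMatrix, Matrix.det_mul, det_colMatrix]
      exact hMdet.mul (c.isUnit_intDet i)
    · rw [hval F]; exact mul_pos hε (c.f_pos i)
    · rw [hval F.swap, hval F.swap]
      have h1 := c.h_alt i
      have h2 : 0 < y ^ 2 := by have := F.swap.x_ne_zero; positivity
      calc _ = ((ε : ℤ) * (ε : ℤ)) * (y ^ 2 * (onInt h (v i) * onInt h (v (i + 1)))) := by ring
        _ < 0 := by rw [hε2, one_mul]; exact mul_neg_of_pos_of_neg h2 h1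
  obtain ⟨j, hj, hs⟩ := c.exists_shift d
  refine ⟨ε, j, fun i => ?_, hs⟩
  rw [← hj, smul_smul, Int.units_mul_self, one_smul]

end IsEigenFrame

/-- A real left eigenvector of a positive matrix for the larger eigenvalue has coordinates of
equal sign, one for the smaller eigenvalue has coordinates of opposite signs. -/
lemma eigenvector_signs {a b c d x y f₁ f₂ h₁ h₂ : ℝ} (hb : 0 < b) (hc : 0 < c) (ha : 0 ≤ a)
    (hd : 0 < d) (hxy : |y| < |x|) (hf₁ : f₁ ≠ 0) (hf₂ : f₂ ≠ 0) (hh₁ : h₁ ≠ 0) (hh₂ : h₂ ≠ 0)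
    (ef₁ : f₁ * a + f₂ * c = x * f₁) (ef₂ : f₁ * b + f₂ * d = x * f₂)
    (eh₁ : h₁ * a + h₂ * c = y * h₁) (eh₂ : h₁ * b + h₂ * d = y * h₂) :
    0 < f₁ * f₂ ∧ h₁ * h₂ < 0 := by
  have hx : (x - a) * (x - d) = b * c := by
    have : (x - a) * (x - d) * (f₁ * f₂) = b * c * (f₁ * f₂) := by
      linear_combination (-f₂ * (x - d)) * ef₁ - f₂ * c * ef₂
    exact mul_right_cancel₀ (mul_ne_zero hf₁ hf₂) this
  have hy : (y - a) * (y - d) = b * c := by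
    have : (y - a) * (y - d) * (h₁ * h₂) = b * c * (h₁ * h₂) := by
      linear_combination (-h₂ * (y - d)) * eh₁ - h₂ * c * eh₂
    exact mul_right_cancel₀ (mul_ne_zero hh₁ hh₂) this
  have hne : x - y ≠ 0 := by
    intro h0
    rw [sub_eq_zero.mp h0] at hxy
    exact lt_irrefl _ hxy
  have htr : x + y = a + d := by
    have : (x - y) * (x + y - (a + d)) = 0 := by linear_combination hx - hy
    rcases mul_eq_zero.mp this with h0 | h0
    · exact absurd h0 hne
    · linarith
  have hxpos : 0 < x := by
    by_contra! hle
    rw [abs_of_nonpos hle] at hxy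
    linarith [le_abs_self y]
  have hlt : y < x := by
    rw [abs_of_pos hxpos] at hxy
    linarith [le_abs_self y]
  have hbc : 0 < b * c := mul_pos hb hc
  have hxa : 0 < x - a ∧ 0 < x - d := by
    rcases pos_and_pos_or_neg_and_neg_of_mul_pos (hx ▸ hbc) with h1 | h1
    · exact h1
    · exfalso; linarith [h1.1, h1.2]
  have k1 : (f₁ * f₂) * c = (x - a) * f₁ ^ 2 := by linear_combination f₁ * ef₁
  have k2 : (h₁ * h₂) * c = (y - a) * h₁ ^ 2 := by linear_combination h₁ * eh₁
  have hya : y - a < 0 := by linarith [hxa.2]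
  constructor
  · have : 0 < (f₁ * f₂) * c := by rw [k1]; exact mul_pos hxa.1 (by positivity)
    exact pos_of_mul_pos_left this hc.le
  · have : (h₁ * h₂) * c < 0 := by rw [k2]; exact mul_neg_of_neg_of_pos hya (by positivity)
    by_contra! h0
    nlinarith

/-! ### Reduced matrices conjugate to `M` -/

/-- In a group, a two-sided sequence can be prescribed by its initial term and its successive
quotients. -/
lemma exists_int_seq {G : Type*} [Group G] (g : G) (b : ℤ → G) :
    ∃ P : ℤ → G, P 0 = g ∧ ∀ i, P (i + 1) = P i * b i := by
  let up : ℕ → G := fun n => Nat.rec g (fun k a => a * b k) n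
  let down : ℕ → G := fun n => Nat.rec g (fun k a => a * (b (-(k : ℤ) - 1))⁻¹) n
  refine ⟨fun i => if 0 ≤ i then up i.toNat else down (-i).toNat, by simp [up], fun i => ?_⟩
  rcases le_or_gt 0 i with hi | hi
  · obtain ⟨n, rfl⟩ := Int.eq_ofNat_of_zero_le hi
    simp only [show (0 : ℤ) ≤ (n : ℤ) + 1 by lia, hi, if_true,
      show ((n : ℤ) + 1).toNat = n + 1 by lia, Int.toNat_natCast]
    rfl
  · obtain ⟨n, rfl⟩ : ∃ n : ℕ, i = -(n : ℤ) - 1 := ⟨(-i - 1).toNat, by lia⟩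
    have e : down (n + 1) * b (-(n : ℤ) - 1) = down n := by
      change down n * (b (-(n : ℤ) - 1))⁻¹ * b (-(n : ℤ) - 1) = down n
      simp
    simp only [show ¬ (0 : ℤ) ≤ -(n : ℤ) - 1 by lia, if_false,
      show (-(-(n : ℤ) - 1)).toNat = n + 1 by lia, e]
    rcases n with _ | n
    · simp [up, down]
    · simp only [show ¬ (0 : ℤ) ≤ -((n + 1 : ℕ) : ℤ) - 1 + 1 by lia, if_false,
        show (-(-((n + 1 : ℕ) : ℤ) - 1 + 1)).toNat = n + 1 by lia]

lemma eq_colMatrix (P : Matrix (Fin 2) (Fin 2) ℤ) :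
    P = colMatrix (fun r => P r 0) (fun r => P r 1) := by
  ext i j
  fin_cases i <;> fin_cases j <;> rfl

/-- Every finite sequence extends to a periodic two-sided sequence. -/
lemma exists_periodic_block {l : List ℕ} (hl : l ≠ []) (hpos : ∀ a ∈ l, 0 < a) :
    ∃ t : ℤ → ℕ, Function.Periodic t (l.length : ℤ) ∧ (∀ i, 0 < t i) ∧
      l = block t 0 l.length := by
  have hn : 0 < l.length := List.length_pos_iff.mpr hl
  have hlt : ∀ i : ℤ, (i % l.length).toNat < l.length := fun i => by
    have h1 := Int.emod_lt_of_pos i (show (0 : ℤ) < l.length by exact_mod_cast hn)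
    have h2 := Int.emod_nonneg i (show (l.length : ℤ) ≠ 0 by lia)
    lia
  refine ⟨fun i => l[(i % l.length).toNat]'(hlt i), fun i => ?_, fun i => ?_, ?_⟩
  · simp
  · exact hpos _ (List.getElem_mem _)
  · rw [eq_block_iff]
    intro i hi
    simp only [zero_add]
    congr 1
    rw [Int.emod_eq_of_lt (by lia) (by exact_mod_cast hi)]
    simp

/-- The columns of the products `g * M_{a_1,…,a_i}` form, up to sign, a chain for `M`, if
`M_{a_1,…,a_n}` is conjugate to `± M` by means of `g`. -/
lemma IsEigenFrame.exists_chain_of_reduced {M : GL (Fin 2) ℤ} {f h : (Fin 2 → ℝ) →ₗ[ℝ] ℝ} {x y : ℝ}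
    (F : IsEigenFrame M f h x y) (hxy : |y| < |x|) {l : List ℕ} (hl : l ≠ [])
    (hpos : ∀ a ∈ l, 0 < a) (g : GL (Fin 2) ℤ) (δ : ℤˣ)
    (hg : M.val * g.val = δ • (g.val * contMatrix l)) :
    ∃ (w : ℤ → Fin 2 → ℤ) (t : ℤ → ℕ) (ε : ℤˣ), IsChain (onInt f) (onInt h) w t ∧
      l = block t 0 l.length ∧ Function.Periodic t (l.length : ℤ) ∧
      w 0 = (ε • fun r => g.val r 0) ∧
      ∀ i, M.val *ᵥ w i = δ • w (i + l.length) := by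
  obtain ⟨t, ht, htpos, hlt⟩ := exists_periodic_block hl hpos
  obtain ⟨P, hP0, hP⟩ := exists_int_seq g fun i => elemGL (t i)
  set n := l.length with hn
  have hnpos : 0 < n := List.length_pos_iff.mpr hl
  have hPv : ∀ i, (P (i + 1)).val = (P i).val * (elemGL (t i)).val := fun i => by
    rw [hP, Units.val_mul]
  have hblock := fun i => eq_mul_contMatrix_block (P := fun i => (P i).val) hPv i n
  have hshift : ∀ i, M.val * (P i).val = δ • (P (i + n)).val := by
    have hstep : ∀ i, M.val * (P i).val = δ • (P (i + n)).val ↔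
        M.val * (P (i + 1)).val = δ • (P (i + 1 + n)).val := fun i => by
      rw [hPv, show i + 1 + (n : ℤ) = i + n + 1 by ring, hPv, ht, ← mul_assoc, ← smul_mul_assoc]
      exact (Units.mul_left_inj _).symm
    intro i
    induction i using Int.induction_on with
    | zero => rw [hblock 0, hP0, ← hlt, hg]
    | succ k ih => exact (hstep _).mp ih
    | pred k ih => rw [hstep, sub_add_cancel]; exact ih
  let w : ℤ → Fin 2 → ℤ := fun i r => (P i).val r 0
  have hPw : ∀ i, (P i).val = colMatrix (w i) (w (i + 1)) := fun i => by
    rw [eq_colMatrix (P i).val]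
    congr 1
    ext r
    simp only [w, hPv]
    simp [Matrix.mul_apply, Fin.sum_univ_two, elemGL]
  have hadd : ∀ i, w (i + 2) = w i + (t i : ℤ) • w (i + 1) := fun i => by
    have h1 := hPv i
    rw [hPw, hPw, colMatrix_mul] at h1
    rw [show i + 2 = i + 1 + 1 by ring, (colMatrix_inj h1).2]
    simp [elemGL]
  have hunit : ∀ i, IsUnit (intDet (w i) (w (i + 1))) := fun i => by
    rw [← det_colMatrix, ← hPw]
    exact (Matrix.isUnit_iff_isUnit_det _).mp (P i).isUnit
  have hMw : ∀ i, M.val *ᵥ w i = δ • w (i + n) := fun i => by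
    have h1 := hshift i
    rw [hPw, hPw, mul_colMatrix, unit_smul_colMatrix] at h1
    exact (colMatrix_inj h1).1
  have hw0 : ∀ i, w i ≠ 0 := fun i h0 => by
    have := hunit i
    simp [intDet, h0] at this
  have hδ : ((δ : ℤ) : ℝ) * ((δ : ℤ) : ℝ) = 1 := by
    rw [← Int.cast_mul]; exact_mod_cast Int.isUnit_mul_self δ.isUnit
  have hδabs : |((δ : ℤ) : ℝ)| = 1 := by
    rcases Int.units_eq_one_or δ with h1 | h1 <;> simp [h1]
  -- Evaluating a functional on the columns of `P i` gives a left eigenvector of the rotated product.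
  have heig : ∀ {f h x y} (_ : IsEigenFrame M f h x y) (i : ℤ),
      let N := contMatrix (block t i n)
      onInt f (w i) * N 0 0 + onInt f (w (i + 1)) * N 1 0 = (δ : ℤ) * x * onInt f (w i) ∧
      onInt f (w i) * N 0 1 + onInt f (w (i + 1)) * N 1 1 = (δ : ℤ) * x * onInt f (w (i + 1)) := by
    intro f h x y F i N
    have h1 := hshift i
    rw [hblock, hPw, mul_colMatrix, colMatrix_mul, unit_smul_colMatrix] at h1
    obtain ⟨h2, h3⟩ := colMatrix_inj h1
    have h4 := congrArg (onInt f) h2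
    have h5 := congrArg (onInt f) h3
    rw [F.onInt_mulVec, Units.smul_def, map_zsmul, map_add, map_zsmul, map_zsmul] at h4 h5
    simp only [zsmul_eq_mul] at h4 h5
    constructor
    · rw [mul_assoc, h4, ← mul_assoc, hδ]; ring
    · rw [mul_assoc, h5, ← mul_assoc, hδ]; ring
  have hsigns : ∀ i, 0 < onInt f (w i) * onInt f (w (i + 1)) ∧
      onInt h (w i) * onInt h (w (i + 1)) < 0 := fun i => by
    obtain ⟨n00, n01, n10, n11⟩ := contMatrix_entries (l := block t i n)
      (by rw [← List.length_pos_iff, length_block]; exact hnpos)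
      (by intro a ha; simp only [block, List.mem_map] at ha; obtain ⟨r, -, rfl⟩ := ha; exact htpos _)
    refine eigenvector_signs (x := (δ : ℤ) * x) (y := (δ : ℤ) * y)
      (by exact_mod_cast n01) (by exact_mod_cast n10) (by exact_mod_cast n00)
      (by exact_mod_cast n11) (by rw [abs_mul, abs_mul, hδabs]; linarith)
      (F.onInt_ne_zero (hw0 _)) (F.onInt_ne_zero (hw0 _)) (F.swap.onInt_ne_zero (hw0 _))
      (F.swap.onInt_ne_zero (hw0 _)) (heig F i).1 (heig F i).2 (heig F.swap i).1 (heig F.swap i).2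
  obtain ⟨ε, hε⟩ : ∃ ε : ℤˣ, 0 < onInt f (ε • w 0) := by
    rcases lt_or_gt_of_ne (F.onInt_ne_zero (hw0 0)) with h1 | h1
    · exact ⟨-1, by simpa using h1⟩
    · exact ⟨1, by simpa using h1⟩
  have hεR : ((ε : ℤ) : ℝ) * ((ε : ℤ) : ℝ) = 1 := by
    rw [← Int.cast_mul]; exact_mod_cast Int.isUnit_mul_self ε.isUnit
  have hmul : ∀ (f : (Fin 2 → ℤ) →+ ℝ) (p q : Fin 2 → ℤ), f (ε • p) * f (ε • q) = f p * f q := by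
    intro f p q
    rw [Units.smul_def, Units.smul_def, map_zsmul, map_zsmul, zsmul_eq_mul, zsmul_eq_mul]
    linear_combination f p * f q * hεR
  refine ⟨fun i => ε • w i, t, ε, ⟨htpos, fun i => ?_, fun i => ?_, fun i => ?_, fun i => ?_⟩, hlt,
    ht, ?_, fun i => ?_⟩
  · simp only [hadd, smul_add]; rw [smul_comm]
  · rw [intDet_smul_smul]; exact hunit i
  · have hstep : ∀ i, 0 < onInt f (ε • w i) ↔ 0 < onInt f (ε • w (i + 1)) := fun i => by
      have h1 : 0 < onInt f (ε • w i) * onInt f (ε • w (i + 1)) := by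
        rw [hmul]; exact (hsigns i).1
      exact ⟨fun h2 => pos_of_mul_pos_right h1 h2.le, fun h2 => pos_of_mul_pos_left h1 h2.le⟩
    induction i using Int.induction_on with
    | zero => exact hε
    | succ k ih => exact (hstep _).mp ih
    | pred k ih => rw [hstep, sub_add_cancel]; exact ih
  · rw [hmul]; exact (hsigns i).2
  · simp only [w, hP0]
  · rw [Units.smul_def, Matrix.mulVec_smul, hMw, ← Units.smul_def, smul_comm]

/-- A reduced matrix that is conjugate to `± M` by means of `g` is the product belonging to the
block of the coefficients of the chain of `M` that starts at the first column of `g`. -/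
lemma IsEigenFrame.eq_block_of_reduced {M : GL (Fin 2) ℤ} {f h : (Fin 2 → ℝ) →ₗ[ℝ] ℝ} {x y : ℝ}
    (F : IsEigenFrame M f h x y) (hxy : |y| < |x|) {v : ℤ → Fin 2 → ℤ} {s : ℤ → ℕ}
    (c : IsChain (onInt f) (onInt h) v s) {ε : ℤˣ} {n : ℕ}
    (hv : ∀ i, M.val *ᵥ v i = ε • v (i + n)) {l : List ℕ} (hl : l ≠ [])
    (hpos : ∀ a ∈ l, 0 < a) (g : GL (Fin 2) ℤ) (δ : ℤˣ)
    (hg : M.val * g.val = δ • (g.val * contMatrix l)) :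
    ∃ j : ℤ, l = block s j n ∧ |onInt f (v j)| = |onInt f fun r => g.val r 0| := by
  obtain ⟨w, t, ε', d, hlt, ht, hw0, hMw⟩ := F.exists_chain_of_reduced hxy hl hpos g δ hg
  obtain ⟨j, hj, hs⟩ := c.exists_shift d
  have habs : ∀ (ε : ℤˣ) (p : Fin 2 → ℤ), |onInt f (ε • p)| = |onInt f p| := fun ε p => by
    rcases Int.units_eq_one_or ε with h1 | h1 <;> simp [h1]
  have hn : l.length = n := by
    have h1 := hMw 0
    rw [hj, hv, hj] at h1
    have h2 := congrArg (fun p => |onInt f p|) h1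
    simp only [habs] at h2
    rw [abs_of_pos (c.f_pos _), abs_of_pos (c.f_pos _)] at h2
    have := c.strictMono_f.injective h2
    lia
  refine ⟨j, ?_, ?_⟩
  · rw [← hn]
    nth_rewrite 1 [hlt]
    simp only [block, hs, zero_add, add_comm j]
  · rw [← habs ε' fun r => g.val r 0, ← hw0, hj, zero_add]

/-! ### Supporting lines of a sail -/

/-- The integer points on which `f` and `h` are positive: for an eigenframe, all nonzero integer
points of the angle `f ≥ 0`, `h ≥ 0`. -/
def posPoints (f h : (Fin 2 → ℝ) →ₗ[ℝ] ℝ) : Set (Fin 2 → ℤ) :=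
  {q | 0 < onInt f q ∧ 0 < onInt h q}

lemma posPoints_comm (f h : (Fin 2 → ℝ) →ₗ[ℝ] ℝ) : posPoints h f = posPoints f h :=
  Set.ext fun _ => and_comm

/-- If the combinations of `t ^ k` and `t ^ (-k)` with coefficients `a`, `b` are bounded below for
`k → ∞`, then the coefficient `a` is nonnegative; if it vanishes, the lower bound is not positive. -/
lemma coeff_nonneg_of_le {t a b m : ℝ} (ht : 1 < t) (hle : ∀ k : ℕ, m ≤ a * t ^ k + b * (t ^ k)⁻¹) :
    0 ≤ a ∧ (a = 0 → m ≤ 0) := by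
  have hpos : ∀ k : ℕ, 0 < t ^ k := fun k => by positivity
  constructor
  · by_contra! ha
    obtain ⟨k, hk⟩ := pow_unbounded_of_one_lt ((|b| + |m| + 1) / (-a)) ht
    rw [div_lt_iff₀ (by linarith)] at hk
    have h1 : b * (t ^ k)⁻¹ ≤ |b| := by
      calc b * (t ^ k)⁻¹ ≤ |b| * (t ^ k)⁻¹ := by
            have := hpos k
            gcongr
            exact le_abs_self b
        _ ≤ |b| * 1 := by
            gcongr
            exact inv_le_one_of_one_le₀ (one_le_pow₀ ht.le)
        _ = |b| := mul_one _
    linarith [hle k, neg_abs_le m]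
  · intro ha
    by_contra! hm
    obtain ⟨k, hk⟩ := pow_unbounded_of_one_lt (b / m) ht
    rw [div_lt_iff₀ hm] at hk
    have h1 := hle k
    rw [ha, zero_mul, zero_add, ← div_eq_mul_inv, le_div_iff₀ (hpos k)] at h1
    linarith

section Hull

variable {f h : (Fin 2 → ℝ) →ₗ[ℝ] ℝ}

/-- A linear inequality valid at the integer points holds on the closed convex hull. -/
lemma le_of_mem_closure_hull {α β m : ℝ}
    (hle : ∀ q ∈ posPoints f h, m ≤ α * onInt f q + β * onInt h q) {a : Fin 2 → ℝ}
    (ha : a ∈ closure (convexHull ℝ (castVec '' posPoints f h))) : m ≤ α * f a + β * h a := by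
  let φ : (Fin 2 → ℝ) →ₗ[ℝ] ℝ := α • f + β • h
  have hcont : Continuous φ := φ.continuous_of_finiteDimensional
  have hcl : IsClosed {p | m ≤ φ p} := isClosed_le continuous_const hcont
  have hcv : Convex ℝ {p | m ≤ φ p} := convex_halfSpace_ge φ.isLinear m
  have hsub : castVec '' posPoints f h ⊆ {p | m ≤ φ p} := by
    rintro _ ⟨q, hq, rfl⟩
    simpa [φ, onInt_apply] using hle q hq
  have := closure_minimal (convexHull_min hsub hcv) hcl ha
  simpa [φ] using this

end Hull

namespace IsEigenFrame

variable {M : GL (Fin 2) ℤ} {f h : (Fin 2 → ℝ) →ₗ[ℝ] ℝ} {x y : ℝ}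

lemma x_sq_ne_one (F : IsEigenFrame M f h x y) : x ^ 2 ≠ 1 := by
  intro h1
  rcases mul_eq_zero.mp (show (x - 1) * (x + 1) = 0 by linear_combination h1) with h2 | h2
  · exact F.irrational_left.ne_one (sub_eq_zero.mp h2)
  · exact F.irrational_left.ne_int (-1) (by push_cast; linarith)

lemma x_ne_y (F : IsEigenFrame M f h x y) : x ≠ y := by
  intro hxy
  have h1 := F.mul_sq
  rw [← hxy] at h1
  have h2 : (x ^ 2 - 1) * (x ^ 2 + 1) = 0 := by linear_combination h1
  rcases mul_eq_zero.mp h2 with h3 | h3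
  · exact F.x_sq_ne_one (by linarith)
  · nlinarith [sq_nonneg x]

/-- The nonzero integer points of the angle lie in its interior. -/
lemma cone_inter_integerPoints (F : IsEigenFrame M f h x y) :
    ({p | 0 ≤ f p ∧ 0 ≤ h p} ∩ integerPoints) \ {0} = castVec '' posPoints f h := by
  ext p
  constructor
  · rintro ⟨⟨⟨h1, h2⟩, h3⟩, h4⟩
    choose q hq using h3
    have hp : castVec q = p := by ext i; simp [hq i]
    have hq0 : q ≠ 0 := by
      rintro rfl
      exact h4 (by rw [← hp]; simp)
    refine ⟨q, ⟨?_, ?_⟩, hp⟩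
    · exact lt_of_le_of_ne (by rw [onInt_apply, hp]; exact h1) (F.onInt_ne_zero hq0).symm
    · exact lt_of_le_of_ne (by rw [onInt_apply, hp]; exact h2) (F.swap.onInt_ne_zero hq0).symm
  · rintro ⟨q, ⟨h1, h2⟩, rfl⟩
    refine ⟨⟨⟨h1.le, h2.le⟩, fun i => ⟨q i, rfl⟩⟩, ?_⟩
    intro h0
    rw [Set.mem_singleton_iff] at h0
    rw [onInt_apply, h0, map_zero] at h1
    exact lt_irrefl _ h1

/-- The vectors dual to the functionals. -/
lemma exists_dual (F : IsEigenFrame M f h x y) :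
    ∃ e₁ e₂ : Fin 2 → ℝ, ∀ p, p = f p • e₁ + h p • e₂ := by
  have hinj : Function.Injective (f.prod h) := by
    rw [← LinearMap.ker_eq_bot, LinearMap.ker_eq_bot']
    intro p hp
    exact F.eq_zero p (congrArg Prod.fst hp) (congrArg Prod.snd hp)
  have hsurj : Function.Surjective (f.prod h) :=
    (LinearMap.injective_iff_surjective_of_finrank_eq_finrank (by simp)).mp hinj
  obtain ⟨e₁, he₁⟩ := hsurj (1, 0)
  obtain ⟨e₂, he₂⟩ := hsurj (0, 1)
  refine ⟨e₁, e₂, fun p => hinj ?_⟩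
  rw [map_add, map_smul, map_smul, he₁, he₂]
  ext <;> simp

lemma eq_of_eq (F : IsEigenFrame M f h x y) {p q : Fin 2 → ℝ} (h1 : f p = f q) (h2 : h p = h q) :
    p = q :=
  sub_eq_zero.mp (F.eq_zero _ (by rw [map_sub, h1, sub_self]) (by rw [map_sub, h2, sub_self]))

/-- The norm form `f * h` is a fixed multiple of the integral form `det (p, M p)`, so it is bounded
away from zero on the integer points. -/
lemma exists_pos_le_mul (F : IsEigenFrame M f h x y) :
    ∃ c : ℝ, 0 < c ∧ ∀ q ∈ posPoints f h, c ≤ onInt f q * onInt h q := by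
  set κ : ℝ := f (Pi.single 0 1) * h (Pi.single 1 1) - f (Pi.single 1 1) * h (Pi.single 0 1)
    with hκ
  have hexp : ∀ (f : (Fin 2 → ℝ) →ₗ[ℝ] ℝ) (q : Fin 2 → ℤ),
      onInt f q = q 0 * f (Pi.single 0 1) + q 1 * f (Pi.single 1 1) := fun f q => by
    have : castVec q = (q 0 : ℝ) • Pi.single 0 1 + (q 1 : ℝ) • Pi.single 1 1 := by
      ext i; fin_cases i <;> simp
    rw [onInt_apply, this, map_add, map_smul, map_smul, smul_eq_mul, smul_eq_mul]
  have hform : ∀ q, (y - x) * (onInt f q * onInt h q) = κ * intDet q (M.val *ᵥ q) := fun q => by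
    have h1 := hexp f (M.val *ᵥ q)
    have h2 := hexp h (M.val *ᵥ q)
    rw [F.onInt_mulVec] at h1
    rw [F.swap.onInt_mulVec] at h2
    have h3 := hexp f q
    have h4 := hexp h q
    calc (y - x) * (onInt f q * onInt h q)
        = onInt f q * (y * onInt h q) - onInt h q * (x * onInt f q) := by ring
      _ = κ * intDet q (M.val *ᵥ q) := by
        rw [h1, h2, h3, h4, hκ, intDet]; push_cast; ring
  have hxy : 0 < |y - x| := abs_pos.mpr (sub_ne_zero.mpr F.x_ne_y.symm)
  rcases (posPoints f h).eq_empty_or_nonempty with he | ⟨q₀, hq₀⟩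
  · exact ⟨1, one_pos, by simp [he]⟩
  have hκ0 : κ ≠ 0 := by
    intro h0
    have h1 := hform q₀
    rw [h0, zero_mul] at h1
    rcases mul_eq_zero.mp h1 with h2 | h2
    · rw [h2] at hxy; simp at hxy
    · exact (mul_pos hq₀.1 hq₀.2).ne' h2
  refine ⟨|κ| / |y - x|, div_pos (abs_pos.mpr hκ0) hxy, fun q hq => ?_⟩
  have hpos := mul_pos hq.1 hq.2
  have h1 := congrArg abs (hform q)
  rw [abs_mul, abs_of_pos hpos, abs_mul] at h1
  rw [div_le_iff₀ hxy, mul_comm, h1]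
  have hint : intDet q (M.val *ᵥ q) ≠ 0 := by
    intro h0
    rw [h0] at h1
    simp only [Int.cast_zero, abs_zero, mul_zero] at h1
    exact (mul_pos hxy hpos).ne' h1
  have h2 : (1 : ℝ) ≤ |(intDet q (M.val *ᵥ q) : ℝ)| := by
    exact_mod_cast Int.one_le_abs hint
  nlinarith [abs_pos.mpr hκ0]

/-- The closed convex hull of the integer points does not meet the edges of the angle. -/
lemma pos_of_mem_closure (F : IsEigenFrame M f h x y) {a : Fin 2 → ℝ}
    (ha : a ∈ closure (convexHull ℝ (castVec '' posPoints f h))) : 0 < f a := by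
  obtain ⟨c, hc, hle⟩ := F.exists_pos_le_mul
  have h1 : 0 ≤ f a := by
    simpa using le_of_mem_closure_hull (α := 1) (β := 0) (m := 0)
      (fun q hq => by simpa using hq.1.le) ha
  have h2 : 0 ≤ h a := by
    simpa using le_of_mem_closure_hull (α := 0) (β := 1) (m := 0)
      (fun q hq => by simpa using hq.2.le) ha
  -- By the inequality of the means, `r f + h / r ≥ 2 √(f h)` for every `r > 0`.
  have hsqrt : 0 < √c := Real.sqrt_pos.mpr hc
  have key : ∀ r : ℝ, 0 < r → 2 * √c ≤ r * f a + r⁻¹ * h a := fun r hr => by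
    refine le_of_mem_closure_hull (fun q hq => ?_) ha
    refine abs_le_of_sq_le_sq' ?_ ?_ |>.2
    · have h3 := hle q hq
      have h4 : r * r⁻¹ = 1 := mul_inv_cancel₀ hr.ne'
      have h5 : (r * onInt f q + r⁻¹ * onInt h q) ^ 2 =
          (r * onInt f q - r⁻¹ * onInt h q) ^ 2 + 4 * (onInt f q * onInt h q) := by
        linear_combination 4 * onInt f q * onInt h q * h4
      rw [h5, mul_pow, Real.sq_sqrt hc.le]
      nlinarith [sq_nonneg (r * onInt f q - r⁻¹ * onInt h q)]
    · have := hq.1; have := hq.2; positivity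
  refine lt_of_le_of_ne h1 fun h0 => ?_
  have hr : 0 < (h a + 1) / √c := by positivity
  have h3 := key _ hr
  rw [← h0, mul_zero, zero_add, inv_div, div_mul_eq_mul_div, le_div_iff₀ (by positivity)] at h3
  nlinarith

/-- The matrix `M ^ 2` and its inverse preserve the integer points of the angle. -/
lemma exists_mul_sq (F : IsEigenFrame M f h x y) {q : Fin 2 → ℤ} (hq : q ∈ posPoints f h) :
    (∃ q' ∈ posPoints f h, onInt f q' = x ^ 2 * onInt f q ∧ onInt h q' = y ^ 2 * onInt h q) ∧
    ∃ q' ∈ posPoints f h, onInt f q' = y ^ 2 * onInt f q ∧ onInt h q' = x ^ 2 * onInt h q := by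
  have hx := F.x_ne_zero
  have hy := F.swap.x_ne_zero
  have hxy := F.mul_sq
  have hinv : ∀ {f h x y} (_ : IsEigenFrame M f h x y) (p : Fin 2 → ℤ),
      onInt f ((M⁻¹).val *ᵥ p) = x⁻¹ * onInt f p := fun {f h x y} F p => by
    have h1 := F.onInt_mulVec ((M⁻¹).val *ᵥ p)
    rw [Matrix.mulVec_mulVec, ← Units.val_mul, mul_inv_cancel, Units.val_one,
      Matrix.one_mulVec] at h1
    rw [h1, inv_mul_cancel_left₀ F.x_ne_zero]
  have hx2 : x⁻¹ ^ 2 = y ^ 2 := by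
    field_simp
    linear_combination -hxy
  have hy2 : y⁻¹ ^ 2 = x ^ 2 := by
    field_simp
    linear_combination -hxy
  have e1 : onInt f (M.val *ᵥ (M.val *ᵥ q)) = x ^ 2 * onInt f q := by
    rw [F.onInt_mulVec, F.onInt_mulVec]; ring
  have e2 : onInt h (M.val *ᵥ (M.val *ᵥ q)) = y ^ 2 * onInt h q := by
    rw [F.swap.onInt_mulVec, F.swap.onInt_mulVec]; ring
  have e3 : onInt f ((M⁻¹).val *ᵥ ((M⁻¹).val *ᵥ q)) = y ^ 2 * onInt f q := by
    rw [hinv F, hinv F, ← hx2]; ring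
  have e4 : onInt h ((M⁻¹).val *ᵥ ((M⁻¹).val *ᵥ q)) = x ^ 2 * onInt h q := by
    rw [hinv F.swap, hinv F.swap, ← hy2]; ring
  obtain ⟨h1, h2⟩ := hq
  refine ⟨⟨_, ⟨?_, ?_⟩, e1, e2⟩, _, ⟨?_, ?_⟩, e3, e4⟩
  · rw [e1]; positivity
  · rw [e2]; positivity
  · rw [e3]; positivity
  · rw [e4]; positivity

/-- The integer points of the angle admit stretching along either edge by a common factor. -/
lemma exists_stretch (F : IsEigenFrame M f h x y) :
    ∃ t : ℝ, 1 < t ∧ ∀ q ∈ posPoints f h, ∀ k : ℕ,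
      (∃ q' ∈ posPoints f h, onInt f q' = t ^ k * onInt f q ∧
        onInt h q' = (t ^ k)⁻¹ * onInt h q) ∧
      ∃ q' ∈ posPoints f h, onInt f q' = (t ^ k)⁻¹ * onInt f q ∧
        onInt h q' = t ^ k * onInt h q := by
  have hx2 : 0 < x ^ 2 := by have := F.x_ne_zero; positivity
  have hy2 : 0 < y ^ 2 := by have := F.swap.x_ne_zero; positivity
  have hxy : x ^ 2 * y ^ 2 = 1 := by rw [← mul_pow]; exact F.mul_sq
  obtain ⟨t, ht, hstep⟩ : ∃ t : ℝ, 1 < t ∧ ∀ q ∈ posPoints f h,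
      (∃ q' ∈ posPoints f h, onInt f q' = t * onInt f q ∧ onInt h q' = t⁻¹ * onInt h q) ∧
      ∃ q' ∈ posPoints f h, onInt f q' = t⁻¹ * onInt f q ∧ onInt h q' = t * onInt h q := by
    rcases lt_or_gt_of_ne F.x_sq_ne_one with h1 | h1
    · refine ⟨y ^ 2, by nlinarith, fun q hq => ?_⟩
      rw [show (y ^ 2)⁻¹ = x ^ 2 from inv_eq_of_mul_eq_one_left hxy]
      exact (F.exists_mul_sq hq).symm
    · refine ⟨x ^ 2, h1, fun q hq => ?_⟩
      rw [show (x ^ 2)⁻¹ = y ^ 2 from inv_eq_of_mul_eq_one_right hxy]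
      exact F.exists_mul_sq hq
  refine ⟨t, ht, fun q hq k => ?_⟩
  induction k with
  | zero => exact ⟨⟨q, hq, by simp⟩, q, hq, by simp⟩
  | succ k ih =>
    obtain ⟨⟨q₁, hq₁, h1, h2⟩, q₂, hq₂, h3, h4⟩ := ih
    obtain ⟨⟨r₁, hr₁, h5, h6⟩, -⟩ := hstep q₁ hq₁
    obtain ⟨-, r₂, hr₂, h7, h8⟩ := hstep q₂ hq₂
    refine ⟨⟨r₁, hr₁, ?_, ?_⟩, r₂, hr₂, ?_, ?_⟩
    · rw [h5, h1]; ring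
    · rw [h6, h2, pow_succ, mul_inv]; ring
    · rw [h7, h3, pow_succ, mul_inv]; ring
    · rw [h8, h4]; ring

lemma interior_hull_nonempty (F : IsEigenFrame M f h x y) (hne : (posPoints f h).Nonempty) :
    (interior (convexHull ℝ (castVec '' posPoints f h))).Nonempty := by
  obtain ⟨q, hq⟩ := hne
  obtain ⟨t, ht, hstep⟩ := F.exists_stretch
  obtain ⟨⟨q', hq', hf, hh⟩, -⟩ := hstep q hq 1
  rw [pow_one] at hf hh
  have hspan : (affineSpan ℝ (castVec '' posPoints f h) : Set (Fin 2 → ℝ)).Nonempty :=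
    (affineSpan_nonempty ℝ).mpr ⟨_, q, hq, rfl⟩
  rw [(convex_convexHull ℝ _).interior_nonempty_iff_affineSpan_eq_top, affineSpan_convexHull,
    ← AffineSubspace.direction_eq_top_iff_of_nonempty hspan, direction_affineSpan, eq_top_iff]
  have hadd : ∀ r ∈ posPoints f h, q + r ∈ posPoints f h := fun r hr => by
    refine ⟨?_, ?_⟩ <;> rw [map_add]
    exacts [add_pos hq.1 hr.1, add_pos hq.2 hr.2]
  have hmem : ∀ r ∈ posPoints f h, castVec r ∈ vectorSpan ℝ (castVec '' posPoints f h) :=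
    fun r hr => by
      have := vsub_mem_vectorSpan ℝ (Set.mem_image_of_mem castVec (hadd r hr))
        (Set.mem_image_of_mem castVec hq)
      simpa using this
  intro p _
  have h1 := hq.1
  have h2 := hq.2
  have ht0 : t - t⁻¹ ≠ 0 := by
    have := inv_lt_one_of_one_lt₀ ht
    linarith
  set b := (f p / onInt f q - h p / onInt h q) / (t - t⁻¹) with hb
  have hb' : b * (t - t⁻¹) = f p / onInt f q - h p / onInt h q := div_mul_cancel₀ _ ht0
  set a := f p / onInt f q - b * t with ha
  have hp : p = a • castVec q + b • castVec q' := by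
    refine F.eq_of_eq ?_ ?_
    · rw [map_add, map_smul, map_smul, ← onInt_apply, ← onInt_apply, hf, ha]
      simp only [smul_eq_mul]
      field_simp
      ring
    · rw [map_add, map_smul, map_smul, ← onInt_apply, ← onInt_apply, hh, smul_eq_mul, smul_eq_mul]
      have h3 : a + b * t⁻¹ = h p / onInt h q := by rw [ha]; linear_combination -hb'
      calc h p = h p / onInt h q * onInt h q := by field_simp
        _ = _ := by rw [← h3]; ring
  rw [hp]
  exact add_mem (Submodule.smul_mem _ _ (hmem q hq)) (Submodule.smul_mem _ _ (hmem q' hq'))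

/-- Every point of a sail lies on a supporting line `α f + β h = 1` with positive `α` and `β`. -/
lemma exists_support (F : IsEigenFrame M f h x y) (hne : (posPoints f h).Nonempty)
    {a : Fin 2 → ℝ} (ha : a ∈ frontier (convexHull ℝ (castVec '' posPoints f h))) :
    ∃ α β : ℝ, 0 < α ∧ 0 < β ∧ α * f a + β * h a = 1 ∧
      ∀ p ∈ closure (convexHull ℝ (castVec '' posPoints f h)), 1 ≤ α * f p + β * h p := by
  set K := convexHull ℝ (castVec '' posPoints f h) with hK
  have hint := F.interior_hull_nonempty hne
  have hacl : a ∈ closure K := frontier_subset_closure ha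
  have hfa : 0 < f a := F.pos_of_mem_closure hacl
  have hha : 0 < h a := by
    refine F.swap.pos_of_mem_closure ?_
    rwa [posPoints_comm]
  obtain ⟨φ, u, hφ, hle, hge⟩ := geometric_hahn_banach_of_nonempty_interior
    (convex_convexHull ℝ (castVec '' posPoints f h)) (convex_singleton a)
    (Set.disjoint_singleton_right.mpr ha.2) hint (Set.singleton_nonempty a)
  obtain ⟨e₁, e₂, he⟩ := F.exists_dual
  have hrep : ∀ p, φ p = f p * φ e₁ + h p * φ e₂ := fun p => by
    conv_lhs => rw [he p]
    simp
  set α := -φ e₁ with hα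
  set β := -φ e₂ with hβ
  set m := α * f a + β * h a with hm
  have hQ : ∀ q ∈ posPoints f h, m ≤ α * onInt f q + β * onInt h q := fun q hq => by
    have h1 := hle _ (subset_convexHull ℝ _ (Set.mem_image_of_mem castVec hq))
    have h2 := hge a rfl
    rw [hrep] at h1 h2
    rw [onInt_apply, onInt_apply, hm, hα, hβ]
    linarith
  obtain ⟨q, hq⟩ := hne
  obtain ⟨t, ht, hstep⟩ := F.exists_stretch
  have hA := coeff_nonneg_of_le (a := α * onInt f q) (b := β * onInt h q) (m := m) ht fun k => by
    obtain ⟨⟨q', hq', h1, h2⟩, -⟩ := hstep q hq k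
    have h3 := hQ q' hq'
    rw [h1, h2] at h3
    linarith
  have hB := coeff_nonneg_of_le (a := β * onInt h q) (b := α * onInt f q) (m := m) ht fun k => by
    obtain ⟨-, q', hq', h1, h2⟩ := hstep q hq k
    have h3 := hQ q' hq'
    rw [h1, h2] at h3
    linarith
  have hα0 : 0 ≤ α := nonneg_of_mul_nonneg_left hA.1 hq.1
  have hβ0 : 0 ≤ β := nonneg_of_mul_nonneg_left hB.1 hq.2
  have hmpos : 0 < m := by
    by_contra! hmle
    have h1 : 0 ≤ α * f a := mul_nonneg hα0 hfa.le
    have h2 : 0 ≤ β * h a := mul_nonneg hβ0 hha.le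
    have h3 : α * f a = 0 := by linarith
    have h4 : β * h a = 0 := by linarith
    have h5 : α = 0 := by simpa [hfa.ne'] using h3
    have h6 : β = 0 := by simpa [hha.ne'] using h4
    refine hφ (ContinuousLinearMap.ext fun p => ?_)
    rw [hrep, show φ e₁ = 0 by linarith, show φ e₂ = 0 by linarith]
    simp
  have hαpos : 0 < α := lt_of_le_of_ne hα0 fun h0 => by
    have := hA.2 (by rw [← h0, zero_mul]); linarith
  have hβpos : 0 < β := lt_of_le_of_ne hβ0 fun h0 => by
    have := hB.2 (by rw [← h0, zero_mul]); linarith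
  refine ⟨α / m, β / m, div_pos hαpos hmpos, div_pos hβpos hmpos, ?_, fun p hp => ?_⟩
  · field_simp; exact hm.symm
  · have := le_of_mem_closure_hull hQ hp
    rw [div_mul_eq_mul_div, div_mul_eq_mul_div, ← add_div, le_div_iff₀ hmpos, one_mul]
    exact this

/-- Three points of a line `α f + β h = 1` are collinear. -/
lemma collinear_of_line (F : IsEigenFrame M f h x y) {α β : ℝ} (hβ : β ≠ 0) {p q r : Fin 2 → ℝ}
    (hp : α * f p + β * h p = 1) (hq : α * f q + β * h q = 1) (hr : α * f r + β * h r = 1) :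
    Collinear ℝ {p, q, r} := by
  obtain ⟨e₁, e₂, he⟩ := F.exists_dual
  rw [collinear_iff_of_mem (p₀ := p) (by simp)]
  refine ⟨β • e₁ - α • e₂, fun z hz => ⟨(f z - f p) / β, ?_⟩⟩
  have hz' : α * f z + β * h z = 1 := by
    rcases hz with rfl | rfl | rfl <;> assumption
  have h1 : h z - h p = -((f z - f p) / β * α) := by
    field_simp
    linarith
  have h2 : z - p = (f z - f p) • e₁ + (h z - h p) • e₂ := by
    have := he (z - p)
    rwa [map_sub, map_sub] at this
  rw [vadd_eq_add, ← sub_eq_iff_eq_add, h2, h1]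
  rw [smul_sub, smul_smul, smul_smul, div_mul_cancel₀ _ hβ, neg_smul,
    ← sub_eq_add_neg]

/-- Only finitely many integer points of the angle lie below a supporting line. -/
lemma finite_posPoints_le (F : IsEigenFrame M f h x y) {α β : ℝ} (hα : 0 < α) (hβ : 0 < β)
    (m : ℝ) : {q ∈ posPoints f h | α * onInt f q + β * onInt h q ≤ m}.Finite := by
  obtain ⟨e₁, e₂, he⟩ := F.exists_dual
  let R : Fin 2 → ℝ := fun i => m / α * |e₁ i| + m / β * |e₂ i|
  refine (Set.finite_Icc (fun i => -⌈R i⌉) (fun i => ⌈R i⌉)).subset ?_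
  rintro q ⟨⟨h1, h2⟩, h3⟩
  have hf : onInt f q ≤ m / α := by
    rw [le_div_iff₀ hα]; nlinarith [mul_pos hβ h2]
  have hh : onInt h q ≤ m / β := by
    rw [le_div_iff₀ hβ]; nlinarith [mul_pos hα h1]
  have habs : ∀ i, |(q i : ℝ)| ≤ R i := fun i => by
    have h4 := congrFun (he (castVec q)) i
    simp only [castVec_apply, Pi.add_apply, Pi.smul_apply, smul_eq_mul, ← onInt_apply] at h4
    rw [h4]
    refine (abs_add_le _ _).trans ?_
    rw [abs_mul, abs_mul, abs_of_pos h1, abs_of_pos h2]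
    exact add_le_add (mul_le_mul_of_nonneg_right hf (abs_nonneg _))
      (mul_le_mul_of_nonneg_right hh (abs_nonneg _))
  constructor
  · intro i
    have h5 := (abs_le.mp (habs i)).1
    have h6 := Int.le_ceil (R i)
    have : (-⌈R i⌉ : ℝ) ≤ q i := by linarith
    exact_mod_cast this
  · intro i
    have h5 := (abs_le.mp (habs i)).2
    have h6 := Int.le_ceil (R i)
    have : (q i : ℝ) ≤ ⌈R i⌉ := by linarith
    exact_mod_cast this

/-- A point where two supporting lines cross transversally is an integer point: otherwise the sum of
the two functionals would be bounded away from its minimum on the integer points. -/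
lemma exists_int_of_two_supports (F : IsEigenFrame M f h x y) {a : Fin 2 → ℝ}
    (ha : a ∈ closure (convexHull ℝ (castVec '' posPoints f h))) {α₁ β₁ α₂ β₂ : ℝ}
    (hα₁ : 0 < α₁) (hβ₁ : 0 < β₁) (hα₂ : 0 < α₂) (hβ₂ : 0 < β₂)
    (e₁ : α₁ * f a + β₁ * h a = 1) (e₂ : α₂ * f a + β₂ * h a = 1)
    (hle₁ : ∀ q ∈ posPoints f h, 1 ≤ α₁ * onInt f q + β₁ * onInt h q)
    (hle₂ : ∀ q ∈ posPoints f h, 1 ≤ α₂ * onInt f q + β₂ * onInt h q)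
    (hne : α₁ * β₂ - α₂ * β₁ ≠ 0) : ∃ q ∈ posPoints f h, castVec q = a := by
  by_contra! hcon
  have hgt : ∀ q ∈ posPoints f h, 2 < (α₁ + α₂) * onInt f q + (β₁ + β₂) * onInt h q := by
    intro q hq
    refine lt_of_le_of_ne (by linarith [hle₁ q hq, hle₂ q hq]) fun h0 => hcon q hq ?_
    have k1 : α₁ * onInt f q + β₁ * onInt h q = 1 := by linarith [hle₁ q hq, hle₂ q hq]
    have k2 : α₂ * onInt f q + β₂ * onInt h q = 1 := by linarith [hle₁ q hq, hle₂ q hq]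
    rw [onInt_apply, onInt_apply] at k1 k2
    refine F.eq_of_eq ?_ ?_ <;> refine mul_left_cancel₀ hne ?_
    · linear_combination β₂ * k1 - β₁ * k2 - β₂ * e₁ + β₁ * e₂
    · linear_combination α₁ * k2 - α₂ * k1 - α₁ * e₂ + α₂ * e₁
  obtain ⟨m, hm, hmle⟩ : ∃ m : ℝ, 2 < m ∧
      ∀ q ∈ posPoints f h, m ≤ (α₁ + α₂) * onInt f q + (β₁ + β₂) * onInt h q := by
    have hfin := F.finite_posPoints_le (add_pos hα₁ hα₂) (add_pos hβ₁ hβ₂) 3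
    rcases Set.eq_empty_or_nonempty
      {q ∈ posPoints f h | (α₁ + α₂) * onInt f q + (β₁ + β₂) * onInt h q ≤ 3} with he | hn
    · refine ⟨3, by norm_num, fun q hq => ?_⟩
      by_contra! hlt
      exact (Set.eq_empty_iff_forall_notMem.mp he q) ⟨hq, hlt.le⟩
    · obtain ⟨q₀, ⟨hq₀, hq₀3⟩, hmin⟩ := Set.exists_min_image _
        (fun q => (α₁ + α₂) * onInt f q + (β₁ + β₂) * onInt h q) hfin hn
      refine ⟨_, hgt q₀ hq₀, fun q hq => ?_⟩
      by_cases h3 : (α₁ + α₂) * onInt f q + (β₁ + β₂) * onInt h q ≤ 3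
      · exact hmin q ⟨hq, h3⟩
      · linarith
  have := le_of_mem_closure_hull hmle ha
  linarith

end IsEigenFrame

/-! ### From sails to chains -/

/-- A broken line with integer vertices `A k`, in the region where `f` and `h` are positive, whose
edges lie on the lines `α k * f + β k * h = 1`; these lines support the integer points of the
region, and neighbouring lines are distinct. -/
structure IsConvexLine (f h : (Fin 2 → ℤ) →+ ℝ) (A : ℤ → Fin 2 → ℤ) (α β : ℤ → ℝ) : Prop where
  α_pos : ∀ k, 0 < α k
  β_pos : ∀ k, 0 < β k
  f_pos : ∀ k, 0 < f (A k)
  h_pos : ∀ k, 0 < h (A k)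
  left : ∀ k, α k * f (A k) + β k * h (A k) = 1
  right : ∀ k, α k * f (A (k + 1)) + β k * h (A (k + 1)) = 1
  le : ∀ k q, 0 < f q → 0 < h q → 1 ≤ α k * f q + β k * h q
  lt_right : ∀ k, 1 < α k * f (A (k + 2)) + β k * h (A (k + 2))
  lt_left : ∀ k, 1 < α (k + 1) * f (A k) + β (k + 1) * h (A k)

namespace IsConvexLine

variable {f h : (Fin 2 → ℤ) →+ ℝ} {A : ℤ → Fin 2 → ℤ} {α β : ℤ → ℝ}

lemma swap (L : IsConvexLine f h A α β) : IsConvexLine h f A β α where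
  α_pos := L.β_pos
  β_pos := L.α_pos
  f_pos := L.h_pos
  h_pos := L.f_pos
  left k := by rw [add_comm]; exact L.left k
  right k := by rw [add_comm]; exact L.right k
  le k q h1 h2 := by rw [add_comm]; exact L.le k q h2 h1
  lt_right k := by rw [add_comm]; exact L.lt_right k
  lt_left k := by rw [add_comm]; exact L.lt_left k

/-- By convexity, the increments of `f` along two successive edges have the same sign. -/
lemma mul_pos_f (L : IsConvexLine f h A α β) (k : ℤ) :
    0 < (f (A (k + 1)) - f (A k)) * (f (A (k + 2)) - f (A (k + 1))) := by
  have a₁ := L.left k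
  have a₂ := L.right k
  have a₃ := L.lt_right k
  have b₁ := L.left (k + 1)
  have b₂ := L.right (k + 1)
  have b₃ := L.lt_left k
  rw [show k + 1 + 1 = k + 2 by ring] at b₂
  have p₁ := L.β_pos k
  have p₂ := L.β_pos (k + 1)
  generalize f (A k) = x₀ at *
  generalize f (A (k + 1)) = x₁ at *
  generalize f (A (k + 2)) = x₂ at *
  generalize h (A k) = y₀ at *
  generalize h (A (k + 1)) = y₁ at *
  generalize h (A (k + 2)) = y₂ at *
  generalize α k = a at *
  generalize α (k + 1) = a' at *
  generalize β k = b at *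
  generalize β (k + 1) = b' at *
  have c₁ : 0 < (a * b' - a' * b) * (x₂ - x₁) := by
    have : (a * b' - a' * b) * (x₂ - x₁) = b' * (a * x₂ + b * y₂ - 1) := by
      linear_combination b * b₁ - b' * a₂ - b * b₂
    rw [this]
    exact mul_pos p₂ (by linarith)
  have c₂ : 0 < (a * b' - a' * b) * (x₁ - x₀) := by
    have : (a * b' - a' * b) * (x₁ - x₀) = b * (a' * x₀ + b' * y₀ - 1) := by
      linear_combination b' * a₂ - b' * a₁ - b * b₁
    rw [this]
    exact mul_pos p₁ (by linarith)
  have c₃ : 0 < (a * b' - a' * b) ^ 2 * ((x₁ - x₀) * (x₂ - x₁)) := by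
    have := mul_pos c₂ c₁
    linarith
  exact pos_of_mul_pos_right c₃ (sq_nonneg _)

/-- The triangle with vertices `0`, `A k`, `A (k + 1)` contains no further integer points below the
edge, so the edge has lattice distance `1` from the origin. -/
lemma exists_edge_vector (L : IsConvexLine f h A α β) (k : ℤ) {s : ℕ} (hs : 0 < s)
    (hdet : |intDet (A k) (A (k + 1))| = s) :
    ∃ b : Fin 2 → ℤ, A (k + 1) = A k + (s : ℤ) • b ∧ IsUnit (intDet (A k) b) := by
  have hfa := L.f_pos k
  have hha := L.h_pos k
  have hfa' := L.f_pos (k + 1)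
  have hha' := L.h_pos (k + 1)
  have el := L.left k
  have er := L.right k
  have hle := L.le k
  generalize A k = a at *
  generalize A (k + 1) = a' at *
  generalize α k = x at *
  generalize β k = y at *
  -- The vertex is a primitive vector.
  have hprim : IsCoprime (a 0) (a 1) := by
    rw [Int.isCoprime_iff_gcd_eq_one]
    set d := Int.gcd (a 0) (a 1) with hd
    obtain ⟨p₀, hp₀⟩ := Int.gcd_dvd_left (a 0) (a 1)
    obtain ⟨p₁, hp₁⟩ := Int.gcd_dvd_right (a 0) (a 1)
    have hap : a = (d : ℤ) • ![p₀, p₁] := by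
      ext i
      fin_cases i
      · simpa using hp₀
      · simpa using hp₁
    have hval : ∀ g : (Fin 2 → ℤ) →+ ℝ, g a = d * g ![p₀, p₁] := fun g => by
      conv_lhs => rw [hap]
      rw [map_zsmul, zsmul_eq_mul]; simp
    rw [hval] at hfa hha
    have hd0 : (0 : ℝ) ≤ d := Nat.cast_nonneg d
    have h1 := hle _ (pos_of_mul_pos_right hfa hd0) (pos_of_mul_pos_right hha hd0)
    rw [hval, hval] at el
    have hdpos : (d : ℝ) ≠ 0 := by intro h0; rw [h0] at hfa; simp at hfa
    have h2 : (d : ℝ) ≤ 1 := by nlinarith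
    have h3 : d ≤ 1 := by exact_mod_cast h2
    have h4 : d ≠ 0 := by exact_mod_cast hdpos
    lia
  obtain ⟨u, w, huw⟩ := hprim
  obtain ⟨c, hc, μ, hμ⟩ : ∃ c : Fin 2 → ℤ, IsUnit (intDet a c) ∧
      ∃ μ : ℤ, a' = μ • a + (s : ℤ) • c := by
    have hc₀ : intDet a ![-w, u] = 1 := by simp [intDet]; linarith
    obtain ⟨μ, ν, hμν⟩ := exists_combination (by rw [hc₀]; exact isUnit_one) a'
    have hν : intDet a a' = ν := by
      have := intDet_combination a ![-w, u] 1 0 μ ν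
      rw [← hμν, hc₀] at this
      simpa using this
    rw [hν] at hdet
    rcases abs_choice ν with h1 | h1
    · exact ⟨![-w, u], by rw [hc₀]; exact isUnit_one, μ, by rw [hμν, ← hdet, h1]⟩
    · refine ⟨-![-w, u], ?_, μ, ?_⟩
      · have : intDet a (-![-w, u]) = -1 := by
          rw [← hc₀]; simp only [intDet, Pi.neg_apply]; ring
        rw [this]; exact isUnit_one.neg
      · rw [hμν, ← hdet, h1, smul_neg, neg_smul, neg_neg]
  have hs0 : (s : ℤ) ≠ 0 := by lia
  have hmod := Int.mul_ediv_add_emod (1 - μ) s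
  have hr0 := Int.emod_nonneg (1 - μ) hs0
  have hrs := Int.emod_lt_of_pos (1 - μ) (show (0 : ℤ) < s by lia)
  generalize (1 - μ) / (s : ℤ) = e at *
  generalize (1 - μ) % (s : ℤ) = r at *
  have ha' : a' + (r - 1) • a = (s : ℤ) • (c - e • a) := by
    have h1 : μ = 1 - s * e - r := by linarith
    rw [hμ, h1]
    module
  have hdetb : intDet a (c - e • a) = intDet a c := by
    simp only [intDet, Pi.sub_apply, Pi.smul_apply, smul_eq_mul]; ring
  have hval : ∀ g : (Fin 2 → ℤ) →+ ℝ, g a' + (r - 1) * g a = s * g (c - e • a) := fun g => by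
    have := congrArg g ha'
    rw [map_add, map_zsmul, map_zsmul, zsmul_eq_mul, zsmul_eq_mul] at this
    push_cast at this
    exact this
  -- Otherwise `c - e • a` is an integer point of the triangle below the edge.
  have hr : r = 0 := by
    by_contra hne
    have hr1 : (1 : ℝ) ≤ r := by exact_mod_cast (show 1 ≤ r by lia)
    have hrsR : (r : ℝ) < s := by exact_mod_cast hrs
    have hsR : (0 : ℝ) < s := by exact_mod_cast hs
    have h1 := hval f
    have h2 := hval h
    have h3 : 0 < f (c - e • a) := by
      refine pos_of_mul_pos_right (a := (s : ℝ)) ?_ hsR.le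
      rw [← h1]
      nlinarith
    have h4 : 0 < h (c - e • a) := by
      refine pos_of_mul_pos_right (a := (s : ℝ)) ?_ hsR.le
      rw [← h2]
      nlinarith
    have h5 := hle _ h3 h4
    have h6 : s * (x * f (c - e • a) + y * h (c - e • a)) = r := by
      linear_combination er - x * h1 - y * h2 + (r - 1) * el
    nlinarith
  refine ⟨c - e • a, ?_, by rw [hdetb]; exact hc⟩
  rw [← ha', hr]
  module

/-- A convex line along which `f` increases is the even part of a chain, whose coefficients are the
integer lengths of the edges and the indices of the angles. -/
lemma exists_chain (L : IsConvexLine f h A α β) (hf : ∀ k, f (A k) < f (A (k + 1))) {s : ℤ → ℕ}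
    (hs : ∀ i, 0 < s i) (heven : ∀ k, |intDet (A k) (A (k + 1))| = s (2 * k))
    (hodd : ∀ k, |intDet (A (k - 1) - A k) (A (k + 1) - A k)| =
      s (2 * k - 1) * (s (2 * (k - 1)) * s (2 * k))) :
    ∃ v, IsChain f h v s ∧ ∀ k, v (2 * k) = A k := by
  choose b hb hbu using fun k => L.exists_edge_vector k (hs (2 * k)) (heven k)
  have hsR : ∀ i, (0 : ℝ) < s i := fun i => by exact_mod_cast hs i
  have hval : ∀ (g : (Fin 2 → ℤ) →+ ℝ) k, g (A (k + 1)) = g (A k) + s (2 * k) * g (b k) := by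
    intro g k
    rw [hb k, map_add, map_zsmul, zsmul_eq_mul]; simp
  have hfb : ∀ k, 0 < f (b k) := fun k => by
    have h1 := hf k
    rw [hval] at h1
    exact pos_of_mul_pos_right (by linarith) (hsR (2 * k)).le
  have hline : ∀ k, α k * f (b k) + β k * h (b k) = 0 := fun k => by
    have h1 := L.left k
    have h2 := L.right k
    rw [hval, hval] at h2
    have h3 : (s (2 * k) : ℝ) * (α k * f (b k) + β k * h (b k)) = 0 := by linarith
    exact (mul_eq_zero.mp h3).resolve_left (hsR _).ne'
  have hhb : ∀ k, h (b k) < 0 := fun k => by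
    have h1 := hline k
    have h2 := mul_pos (L.α_pos k) (hfb k)
    have h3 := L.β_pos k
    by_contra! h4
    nlinarith [mul_nonneg h3.le h4]
  have hdetA : ∀ k, intDet (A (k + 1)) (b k) = intDet (A k) (b k) := fun k => by
    rw [hb k]
    simp only [intDet, Pi.add_apply, Pi.smul_apply, smul_eq_mul]; ring
  -- Successive edge vectors differ by a positive multiple of the common vertex.
  have hstep : ∀ k, b (k + 1) = b k + (s (2 * k + 1) : ℤ) • A (k + 1) := fun k => by
    obtain ⟨μ, ν, hμν⟩ := exists_combination (hbu (k + 1)) (b k)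
    have hdet : intDet (A (k + 1)) (b k) = ν * intDet (A (k + 1)) (b (k + 1)) := by
      have := intDet_combination (A (k + 1)) (b (k + 1)) 1 0 μ ν
      rw [← hμν] at this
      simpa using this
    have hgval : ∀ g : (Fin 2 → ℤ) →+ ℝ, g (b k) = μ * g (A (k + 1)) + ν * g (b (k + 1)) := by
      intro g
      conv_lhs => rw [hμν]
      rw [map_add, map_zsmul, map_zsmul, zsmul_eq_mul, zsmul_eq_mul]
    have hνu : IsUnit ν := by
      have h1 := hbu k
      rw [← hdetA, hdet] at h1
      exact isUnit_of_mul_isUnit_left h1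
    have hν : ν = 1 := by
      rcases Int.isUnit_iff.mp hνu with h1 | h1
      · exact h1
      · exfalso
        -- A sum of two edge vectors cannot be a multiple of a vertex.
        have e1 := hgval f
        have e2 := hgval h
        rw [h1] at e1 e2
        push_cast at e1 e2
        have h2 : 0 < (μ : ℝ) := by
          have := hfb k; have := hfb (k + 1); have := L.f_pos (k + 1)
          by_contra! h0
          nlinarith
        have := hhb k; have := hhb (k + 1); have := L.h_pos (k + 1)
        nlinarith [mul_pos h2 this]
    have hμ : μ < 0 := by
      have h1 := L.lt_right k
      rw [show k + 2 = k + 1 + 1 by ring, hval f (k + 1), hval h (k + 1)] at h1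
      have h2 := L.right k
      have h3 := hline k
      rw [hgval, hgval, hν] at h3
      push_cast at h3
      have h4 : 0 < (s (2 * (k + 1)) : ℝ) * (α k * f (b (k + 1)) + β k * h (b (k + 1))) := by
        linarith
      have h5 := pos_of_mul_pos_right h4 (hsR _).le
      have h6 : (μ : ℝ) = -(α k * f (b (k + 1)) + β k * h (b (k + 1))) := by
        linear_combination h3 - μ * h2
      have : (μ : ℝ) < 0 := by linarith
      exact_mod_cast this
    have hsμ : (s (2 * k + 1) : ℤ) = -μ := by
      have h1 := hodd (k + 1)
      rw [show k + 1 - 1 = k by ring, show 2 * (k + 1) - 1 = 2 * k + 1 by ring] at h1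
      have h2 : intDet (A k - A (k + 1)) (A (k + 1 + 1) - A (k + 1)) =
          -(s (2 * k) * s (2 * (k + 1)) * (μ * intDet (A (k + 1)) (b (k + 1)))) := by
        have h3 : intDet (b k) (b (k + 1)) = μ * intDet (A (k + 1)) (b (k + 1)) := by
          have := intDet_combination (A (k + 1)) (b (k + 1)) μ ν 0 1
          rw [← hμν] at this
          simpa using this
        rw [← h3, hb (k + 1), hb k]
        simp only [intDet, Pi.sub_apply, Pi.add_apply, Pi.smul_apply, smul_eq_mul]
        ring
      have h3 : |intDet (A (k + 1)) (b (k + 1))| = 1 := Int.isUnit_iff_abs_eq.mp (hbu (k + 1))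
      rw [h2, abs_neg, abs_mul, abs_mul, abs_mul, h3, mul_one, abs_of_neg hμ, Nat.abs_cast,
        Nat.abs_cast, mul_comm] at h1
      have h4 : (s (2 * k) * s (2 * (k + 1)) : ℤ) ≠ 0 := by
        have := hs (2 * k); have := hs (2 * (k + 1)); positivity
      exact (mul_right_cancel₀ h4 h1).symm
    rw [hsμ, hμν, hν]
    module
  have hE : ∀ k : ℤ, 2 * k / 2 = k := fun k => by lia
  have hO : ∀ k : ℤ, (2 * k + 1) / 2 = k := fun k => by lia
  let v : ℤ → Fin 2 → ℤ := fun i => if Even i then A (i / 2) else b (i / 2)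
  have vE : ∀ k, v (2 * k) = A k := fun k => by simp [v]
  have vO : ∀ k, v (2 * k + 1) = b k := fun k => by simp [v, hO]
  have vE' : ∀ k, v (2 * k + 2) = A (k + 1) := fun k => by
    rw [show 2 * k + 2 = 2 * (k + 1) by ring, vE]
  refine ⟨v, ⟨hs, fun i => ?_, fun i => ?_, fun i => ?_, fun i => ?_⟩, vE⟩ <;>
    obtain ⟨k, rfl | rfl⟩ := Int.even_or_odd' i
  · rw [vE, vO, vE', hb]
  · rw [show 2 * k + 1 + 2 = 2 * (k + 1) + 1 by ring, vO, vO, show 2 * k + 1 + 1 = 2 * k + 2 by ring,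
      vE', hstep]
  · rw [vE, vO]; exact hbu k
  · rw [show 2 * k + 1 + 1 = 2 * k + 2 by ring, vE', vO, intDet_swap, hdetA]
    exact (hbu k).neg
  · rw [vE]; exact L.f_pos k
  · rw [vO]; exact hfb k
  · rw [vE, vO]; exact mul_neg_of_pos_of_neg (L.h_pos k) (hhb k)
  · rw [show 2 * k + 1 + 1 = 2 * k + 2 by ring, vE', vO]
    exact mul_neg_of_neg_of_pos (hhb k) (L.h_pos _)

lemma monotone_or (L : IsConvexLine f h A α β) :
    (∀ k, f (A k) < f (A (k + 1))) ∨ ∀ k, h (A k) < h (A (k + 1)) := by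
  have hstep : ∀ k, f (A k) < f (A (k + 1)) ↔ f (A (k + 1)) < f (A (k + 1 + 1)) := fun k => by
    have h1 := L.mul_pos_f k
    rw [show k + 1 + 1 = k + 2 by ring]
    constructor <;> intro h2 <;> rcases pos_and_pos_or_neg_and_neg_of_mul_pos h1 with h3 | h3 <;>
      linarith [h3.1, h3.2]
  have hall : ∀ k, f (A k) < f (A (k + 1)) ↔ f (A 0) < f (A (0 + 1)) := fun k => by
    induction k using Int.induction_on with
    | zero => rfl
    | succ n ih => rw [← hstep, ih]
    | pred n ih => rw [hstep, sub_add_cancel, ih]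
  by_cases h0 : f (A 0) < f (A (0 + 1))
  · exact Or.inl fun k => (hall k).mpr h0
  · refine Or.inr fun k => ?_
    have h1 : ¬ f (A k) < f (A (k + 1)) := fun h2 => h0 ((hall k).mp h2)
    have h2 : f (A (k + 1)) - f (A k) ≠ 0 := left_ne_zero_of_mul (L.mul_pos_f k).ne'
    have h3 : f (A (k + 1)) < f (A k) := lt_of_le_of_ne (not_lt.mp h1) fun h4 => h2 (by linarith)
    have h4 := L.left k
    have h5 := L.right k
    have h6 := mul_pos (L.α_pos k) (sub_pos.mpr h3)
    have h7 : 0 < β k * (h (A (k + 1)) - h (A k)) := by linarith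
    linarith [pos_of_mul_pos_right h7 (L.β_pos k).le]

end IsConvexLine

lemma det₂_castVec (p q : Fin 2 → ℤ) : det₂ (castVec p) (castVec q) = intDet p q := by
  simp [det₂, intDet]

lemma segment_mid_mem (p q : Fin 2 → ℝ) : (2⁻¹ : ℝ) • p + (2⁻¹ : ℝ) • q ∈ segment ℝ p q :=
  ⟨2⁻¹, 2⁻¹, by norm_num, by norm_num, by norm_num, rfl⟩

/-- The vertices of a sail are the even part of a chain, traversed in one of the two directions, and
the coefficients of the chain are the terms of the LLS sequence. -/
theorem IsEigenFrame.exists_chain_of_sail {M : GL (Fin 2) ℤ} {f h : (Fin 2 → ℝ) →ₗ[ℝ] ℝ} {x y : ℝ}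
    (F : IsEigenFrame M f h x y) {A : ℤ → Fin 2 → ℝ} {s : ℤ → ℕ}
    (hA : IsBrokenLine A (sail {p | 0 ≤ f p ∧ 0 ≤ h p})) (hs : IsLLSOf A s) :
    (∃ v, IsChain (onInt f) (onInt h) v s ∧ ∀ k, castVec (v (2 * k)) = A k) ∨
      ∃ v, IsChain (onInt h) (onInt f) v s ∧ ∀ k, castVec (v (2 * k)) = A k := by
  obtain ⟨hU, hcol⟩ := hA
  rw [sail, F.cone_inter_integerPoints] at hU
  set K := convexHull ℝ (castVec '' posPoints f h) with hK
  have hseg : ∀ k, segment ℝ (A k) (A (k + 1)) ⊆ frontier K := fun k => by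
    rw [← hU]; exact Set.subset_iUnion (fun k => segment ℝ (A k) (A (k + 1))) k
  have hAcl : ∀ k, A k ∈ closure K := fun k =>
    frontier_subset_closure (hseg k (left_mem_segment ℝ _ _))
  have hne : (posPoints f h).Nonempty := by
    have h1 : K.Nonempty := closure_nonempty_iff.mp ⟨_, hAcl 0⟩
    rw [hK, convexHull_nonempty_iff, Set.image_nonempty] at h1
    exact h1
  have hsub : ∀ q ∈ posPoints f h, castVec q ∈ closure K := fun q hq =>
    subset_closure (subset_convexHull ℝ _ (Set.mem_image_of_mem _ hq))
  -- The line that supports the hull at the midpoint of an edge contains the edge.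
  have hsupp : ∀ k, ∃ α β : ℝ, 0 < α ∧ 0 < β ∧ α * f (A k) + β * h (A k) = 1 ∧
      α * f (A (k + 1)) + β * h (A (k + 1)) = 1 ∧
      ∀ p ∈ closure K, 1 ≤ α * f p + β * h p := fun k => by
    obtain ⟨α, β, hα, hβ, h1, h2⟩ := F.exists_support hne
      (hseg k (segment_mid_mem (A k) (A (k + 1))))
    have h3 := h2 _ (hAcl k)
    have h4 := h2 _ (hAcl (k + 1))
    simp only [map_add, map_smul, smul_eq_mul] at h1
    exact ⟨α, β, hα, hβ, by linarith, by linarith, h2⟩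
  choose α β hα hβ hl hr hle using hsupp
  have hgtr : ∀ k, 1 < α k * f (A (k + 2)) + β k * h (A (k + 2)) := fun k => by
    refine lt_of_le_of_ne (hle k _ (hAcl _)) fun h0 => hcol (k + 1) ?_
    rw [show k + 1 - 1 = k by ring, show k + 1 + 1 = k + 2 by ring]
    exact F.collinear_of_line (hβ k).ne' (hl k) (hr k) h0.symm
  have hgtl : ∀ k, 1 < α (k + 1) * f (A k) + β (k + 1) * h (A k) := fun k => by
    refine lt_of_le_of_ne (hle (k + 1) _ (hAcl _)) fun h0 => hcol (k + 1) ?_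
    rw [show k + 1 - 1 = k by ring]
    exact F.collinear_of_line (hβ (k + 1)).ne' h0.symm (hl (k + 1)) (hr (k + 1))
  have hint : ∀ k, ∃ q ∈ posPoints f h, castVec q = A k := fun k => by
    have e₁ := hr (k - 1)
    have e₂ := hgtl (k - 1)
    have e₃ := hl (k - 1)
    rw [sub_add_cancel] at e₁ e₂
    refine F.exists_int_of_two_supports (hAcl k) (hα (k - 1)) (hβ (k - 1)) (hα k) (hβ k) e₁ (hl k)
      (fun q hq => hle _ _ (hsub q hq)) (fun q hq => hle _ _ (hsub q hq)) fun h0 => ?_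
    -- Proportional functionals with the value `1` at a common point coincide.
    have h1 : 0 < β (k - 1) := hβ _
    have h2 : (α k * f (A (k - 1)) + β k * h (A (k - 1)) - 1) * β (k - 1) = 0 := by
      linear_combination (f (A k) - f (A (k - 1))) * h0 + β k * (e₃ - e₁) + β (k - 1) * hl k
    rcases mul_eq_zero.mp h2 with h3 | h3
    · linarith
    · exact h1.ne' h3
  choose B hB hBA using hint
  have hval : ∀ (g : (Fin 2 → ℝ) →ₗ[ℝ] ℝ) k, onInt g (B k) = g (A k) := fun g k => by
    rw [onInt_apply, hBA]
  have L : IsConvexLine (onInt f) (onInt h) B α β := by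
    refine ⟨hα, hβ, fun k => (hB k).1, fun k => (hB k).2, fun k => ?_, fun k => ?_,
      fun k q h1 h2 => ?_, fun k => ?_, fun k => ?_⟩
    · rw [hval, hval]; exact hl k
    · rw [hval, hval]; exact hr k
    · exact hle k _ (hsub q ⟨h1, h2⟩)
    · rw [hval, hval]; exact hgtr k
    · rw [hval, hval]; exact hgtl k
  have hspos : ∀ i, 0 < s i := fun i => (hs i).1
  have heven : ∀ k, |intDet (B k) (B (k + 1))| = s (2 * k) := fun k => by
    have h1 := (hs (2 * k)).2
    rw [lls, if_pos (even_two_mul k), show 2 * k / 2 = k by lia, ← hBA, ← hBA, det₂_castVec] at h1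
    exact_mod_cast h1.symm
  have hodd : ∀ k, |intDet (B (k - 1) - B k) (B (k + 1) - B k)| =
      s (2 * k - 1) * (s (2 * (k - 1)) * s (2 * k)) := fun k => by
    have h1 := (hs (2 * k - 1)).2
    have h2 := heven (k - 1)
    rw [sub_add_cancel] at h2
    have h2R : |(intDet (B (k - 1)) (B k) : ℝ)| = s (2 * (k - 1)) := by exact_mod_cast h2
    have h3R : |(intDet (B k) (B (k + 1)) : ℝ)| = s (2 * k) := by exact_mod_cast heven k
    rw [lls, if_neg (by rw [Int.not_even_iff_odd]; exact ⟨k - 1, by ring⟩)] at h1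
    simp only [show (2 * k - 1 + 1) / 2 = k by lia] at h1
    rw [← hBA, ← hBA k, ← hBA (k + 1), ← map_sub, ← map_sub, det₂_castVec, det₂_castVec,
      det₂_castVec, abs_div, abs_mul, h2R, h3R, eq_div_iff] at h1
    · exact_mod_cast h1.symm
    · have := hspos (2 * k); have := hspos (2 * (k - 1)); positivity
  rcases L.monotone_or with hf | hh
  · obtain ⟨v, hv, hvB⟩ := L.exists_chain hf hspos heven hodd
    exact Or.inl ⟨v, hv, fun k => by rw [hvB, hBA]⟩
  · obtain ⟨v, hv, hvB⟩ := L.swap.exists_chain hh hspos heven hodd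
    exact Or.inr ⟨v, hv, fun k => by rw [hvB, hBA]⟩

/-! ### The eigenframe of a matrix and the four angles -/

/-- A matrix with irrational real eigenvalues has an eigenframe, in which the eigenvalue of larger
absolute value may be put first. -/
lemma HasRealIrrationalEigenvalues.exists_frame {M : GL (Fin 2) ℤ}
    (hM : HasRealIrrationalEigenvalues M) :
    ∃ (f h : (Fin 2 → ℝ) →ₗ[ℝ] ℝ) (x y : ℝ), IsEigenFrame M f h x y ∧ |y| < |x| := by
  obtain ⟨x, y, hx, hy, hpoly⟩ := hM
  set a : ℤ := M.val 0 0 with ha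
  set b : ℤ := M.val 0 1 with hb
  set c : ℤ := M.val 1 0 with hc
  set d : ℤ := M.val 1 1 with hd
  have heval : ∀ z : ℝ, z ^ 2 - (a + d) * z + (a * d - b * c) = (z - x) * (z - y) := fun z => by
    have := congrArg (Polynomial.eval z) hpoly
    rw [Matrix.charpoly_fin_two] at this
    simpa [Matrix.trace_fin_two, Matrix.det_fin_two, toReal] using this
  have hdet : x * y = a * d - b * c := by linarith [heval 0]
  have htr : x + y = a + d := by linarith [heval 0, heval 1]
  have hsq : (x * y) ^ 2 = 1 := by
    have h1 : IsUnit M.val.det := (Matrix.isUnit_iff_isUnit_det _).mp M.isUnit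
    have h2 := Int.isUnit_mul_self h1
    rw [Matrix.det_fin_two] at h2
    rw [hdet]
    have h3 : ((a * d - b * c) * (a * d - b * c) : ℝ) = 1 := by exact_mod_cast h2
    linear_combination h3
  have hc0 : (c : ℝ) ≠ 0 := by
    intro h0
    have h1 := heval x
    rw [h0, sub_self, zero_mul] at h1
    have h2 : (x - a) * (x - d) = 0 := by linear_combination h1
    rcases mul_eq_zero.mp h2 with h3 | h3
    · exact hx.ne_int a (by linarith)
    · exact hx.ne_int d (by linarith)
  have hne : x ≠ y := by
    intro h0
    refine hx ⟨((a + d : ℤ) : ℚ) / 2, ?_⟩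
    push_cast
    linarith
  let F : ℝ → (Fin 2 → ℝ) →ₗ[ℝ] ℝ := fun z =>
    (c : ℝ) • LinearMap.proj 0 + (z - a) • LinearMap.proj 1
  have hF : ∀ z p, F z p = c * p 0 + (z - a) * p 1 := fun z p => by simp [F]
  have heig : ∀ z : ℝ, z ^ 2 - (a + d) * z + (a * d - b * c) = 0 →
      ∀ p, F z (toReal M *ᵥ p) = z * F z p := fun z hz p => by
    rw [hF, hF]
    have h0 : (toReal M *ᵥ p) 0 = a * p 0 + b * p 1 := by
      simp [toReal, Matrix.mulVec, dotProduct, Fin.sum_univ_two, ha, hb]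
    have h1 : (toReal M *ᵥ p) 1 = c * p 0 + d * p 1 := by
      simp [toReal, Matrix.mulVec, dotProduct, Fin.sum_univ_two, hc, hd]
    rw [h0, h1]
    linear_combination -p 1 * hz
  have hframe : IsEigenFrame M (F x) (F y) x y := by
    refine ⟨heig x (by rw [heval]; ring), heig y (by rw [heval]; ring), fun p h1 h2 => ?_, hx, hy,
      hsq⟩
    rw [hF] at h1 h2
    have h3 : p 1 = 0 := by
      have : (x - y) * p 1 = 0 := by linarith
      exact (mul_eq_zero.mp this).resolve_left (sub_ne_zero.mpr hne)
    have h4 : p 0 = 0 := by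
      rw [h3] at h1
      simpa [hc0] using h1
    ext i
    fin_cases i
    · exact h4
    · exact h3
  rcases lt_trichotomy |y| |x| with h1 | h1 | h1
  · exact ⟨_, _, x, y, hframe, h1⟩
  · exfalso
    have h2 : y ^ 2 = x ^ 2 := sq_eq_sq_iff_abs_eq_abs _ _ |>.mpr h1
    have h3 : (x ^ 2 - 1) * (x ^ 2 + 1) = 0 := by
      rw [mul_pow, h2] at hsq
      linear_combination hsq
    rcases mul_eq_zero.mp h3 with h4 | h4
    · exact hframe.x_sq_ne_one (by linarith)
    · nlinarith [sq_nonneg x]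
  · exact ⟨_, _, y, x, hframe.swap, h1⟩

/-- Each of the four angles is given by two inequalities on multiples of the eigenfunctionals. -/
lemma IsEigenFrame.cone_eq {M : GL (Fin 2) ℤ} {f h : (Fin 2 → ℝ) →ₗ[ℝ] ℝ} {x y : ℝ}
    (F : IsEigenFrame M f h x y) {C : Set (Fin 2 → ℝ)} (hC : IsConeOf M C) :
    ∃ a b : ℝ, a ≠ 0 ∧ b ≠ 0 ∧ C = {p | 0 ≤ (a • f) p ∧ 0 ≤ (b • h) p} := by
  obtain ⟨x', y', v, w, hne, hv, hw, hMv, hMw, rfl⟩ := hC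
  have hval : ∀ {z u}, u ≠ 0 → toReal M *ᵥ u = z • u →
      (z = x ∧ f u ≠ 0 ∧ h u = 0) ∨ (z = y ∧ h u ≠ 0 ∧ f u = 0) := by
    intro z u hu hMu
    have h1 : (z - x) * f u = 0 := by
      have := F.f_mulVec u
      rw [hMu, map_smul, smul_eq_mul] at this
      linear_combination this
    have h2 : (z - y) * h u = 0 := by
      have := F.h_mulVec u
      rw [hMu, map_smul, smul_eq_mul] at this
      linear_combination this
    have hxy := F.x_ne_y
    rcases mul_eq_zero.mp h1 with h3 | h3
    · have hz : z = x := by linarith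
      have h4 : h u = 0 := (mul_eq_zero.mp h2).resolve_left (by rw [hz]; exact sub_ne_zero.mpr hxy)
      exact Or.inl ⟨hz, fun h5 => hu (F.eq_zero u h5 h4), h4⟩
    · have h4 : h u ≠ 0 := fun h5 => hu (F.eq_zero u h3 h5)
      exact Or.inr ⟨by linarith [(mul_eq_zero.mp h2).resolve_right h4], h4, h3⟩
  have hset : ∀ {f h : (Fin 2 → ℝ) →ₗ[ℝ] ℝ} {x y : ℝ}, IsEigenFrame M f h x y →
      f v ≠ 0 → h v = 0 → h w ≠ 0 → f w = 0 →
      angle v w = {p | 0 ≤ (f v • f) p ∧ 0 ≤ (h w • h) p} := by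
    intro f h x y F h1 h2 h3 h4
    have h1' : 0 < f v * f v := mul_self_pos.mpr h1
    have h3' : 0 < h w * h w := mul_self_pos.mpr h3
    ext p
    simp only [LinearMap.smul_apply, smul_eq_mul]
    constructor
    · rintro ⟨s, t, hs, ht, rfl⟩
      have e1 : f v * f (s • v + t • w) = s * (f v * f v) := by
        rw [map_add, map_smul, map_smul, h4, smul_eq_mul, smul_eq_mul]; ring
      have e2 : h w * h (s • v + t • w) = t * (h w * h w) := by
        rw [map_add, map_smul, map_smul, h2, smul_eq_mul, smul_eq_mul]; ring
      exact ⟨by rw [e1]; positivity, by rw [e2]; positivity⟩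
    · rintro ⟨hp1, hp2⟩
      refine ⟨f p / f v, h p / h w, ?_, ?_, ?_⟩
      · rw [← mul_div_mul_left _ _ h1]; exact div_nonneg hp1 h1'.le
      · rw [← mul_div_mul_left _ _ h3]; exact div_nonneg hp2 h3'.le
      · refine F.eq_of_eq ?_ ?_
        · rw [map_add, map_smul, map_smul, h4]; simp [h1]
        · rw [map_add, map_smul, map_smul, h2]; simp [h3]
  rcases hval hv hMv with ⟨h1, h2, h3⟩ | ⟨h1, h2, h3⟩ <;>
    rcases hval hw hMw with ⟨h4, h5, h6⟩ | ⟨h4, h5, h6⟩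
  · exact absurd (h1.trans h4.symm) hne
  · exact ⟨_, _, h2, h5, hset F h2 h3 h5 h6⟩
  · refine ⟨_, _, h5, h2, (hset F.swap h2 h3 h5 h6).trans ?_⟩
    exact Set.ext fun p => and_comm
  · exact absurd (h1.trans h4.symm) hne

lemma IsChain.of_smul {f h : (Fin 2 → ℝ) →ₗ[ℝ] ℝ} {a b : ℝ} {v : ℤ → Fin 2 → ℤ} {s : ℤ → ℕ}
    (hb : b ≠ 0) (c : IsChain (onInt (a • f)) (onInt (b • h)) v s) :
    ∃ ε : ℤˣ, IsChain (onInt f) (onInt h) (fun i => ε • v i) s := by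
  have hval : ∀ (f : (Fin 2 → ℝ) →ₗ[ℝ] ℝ) (a : ℝ) p, onInt (a • f) p = a * onInt f p :=
    fun f a p => rfl
  have halt : ∀ i, onInt h (v i) * onInt h (v (i + 1)) < 0 := fun i => by
    have h1 := c.h_alt i
    rw [hval, hval] at h1
    have h2 : 0 < b * b := mul_self_pos.mpr hb
    by_contra! h3
    nlinarith [mul_nonneg h2.le h3]
  have hf := c.f_pos
  simp only [hval] at hf
  rcases lt_trichotomy a 0 with ha | ha | ha
  · have d : IsChain (-onInt f) (onInt h) v s :=
      ⟨c.pos, c.add_two, c.isUnit_intDet, fun i => by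
        rw [AddMonoidHom.neg_apply]
        exact neg_pos.mpr (neg_of_mul_pos_right (hf i) ha.le), halt⟩
    have := d.neg_left
    rw [neg_neg] at this
    exact ⟨-1, by simpa using this⟩
  · exact absurd (hf 0) (by simp [ha])
  · exact ⟨1, by simpa using
      (⟨c.pos, c.add_two, c.isUnit_intDet, fun i => pos_of_mul_pos_right (hf i) ha.le, halt⟩ :
        IsChain (onInt f) (onInt h) v s)⟩

/-- Each sail of `M` yields a chain for a fixed eigenframe, in one of its two orders. -/
lemma IsEigenFrame.exists_chain_of_isSailOf {M : GL (Fin 2) ℤ} {f h : (Fin 2 → ℝ) →ₗ[ℝ] ℝ} {x y : ℝ}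
    (F : IsEigenFrame M f h x y) {A : ℤ → Fin 2 → ℝ} {s : ℤ → ℕ} (hA : IsSailOf M A)
    (hs : IsLLSOf A s) :
    (∃ (v : ℤ → Fin 2 → ℤ) (ε : ℤˣ), IsChain (onInt f) (onInt h) v s ∧
      ∀ k, castVec (ε • v (2 * k)) = A k) ∨
    ∃ (v : ℤ → Fin 2 → ℤ) (ε : ℤˣ), IsChain (onInt h) (onInt f) v s ∧
      ∀ k, castVec (ε • v (2 * k)) = A k := by
  obtain ⟨C, hC, hB⟩ := hA
  obtain ⟨a, b, ha, hb, rfl⟩ := F.cone_eq hC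
  rcases (F.smul ha hb).exists_chain_of_sail hB hs with ⟨v, c, hv⟩ | ⟨v, c, hv⟩
  · obtain ⟨ε, d⟩ := c.of_smul hb
    exact Or.inl ⟨_, ε, d, fun k => by rw [smul_smul, Int.units_mul_self, one_smul, hv]⟩
  · obtain ⟨ε, d⟩ := c.of_smul ha
    exact Or.inr ⟨_, ε, d, fun k => by rw [smul_smul, Int.units_mul_self, one_smul, hv]⟩

/-- If `M ^ 2` shifts the vertices of a sail by `n`, then `± M` shifts its chain by `n`. -/
lemma IsEigenFrame.shift_eq {M : GL (Fin 2) ℤ} {f h : (Fin 2 → ℝ) →ₗ[ℝ] ℝ} {x y : ℝ}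
    (F : IsEigenFrame M f h x y) {A : ℤ → Fin 2 → ℝ} {v : ℤ → Fin 2 → ℤ} {s : ℤ → ℕ}
    (c : IsChain (onInt f) (onInt h) v s) {ε : ℤˣ} (hv : ∀ k, castVec (ε • v (2 * k)) = A k) {n : ℕ}
    (hn : ∀ k : ℤ, toReal (M ^ 2) *ᵥ A k = A (k + n)) :
    (∃ ε' : ℤˣ, ∀ i, M.val *ᵥ v i = ε' • v (i + n)) ∧
      x ^ 2 * onInt f (v 0) = onInt f (v (2 * n)) := by
  have h1 := hn 0
  rw [← hv, ← hv, toReal_mulVec_castVec] at h1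
  have h2 : (M ^ 2).val *ᵥ v (2 * 0) = v (2 * (0 + n)) := by
    refine MulAction.injective ε ?_
    have h3 := castVec_injective h1
    rwa [Units.smul_def, Matrix.mulVec_smul, ← Units.smul_def] at h3
  rw [mul_zero, zero_add, Units.val_pow_eq_pow_val, pow_two,
    ← Matrix.mulVec_mulVec] at h2
  obtain ⟨ε', j, hj, -⟩ := F.exists_shift c
  have hjn : j = n := by
    have h3 := h2
    rw [hj, Units.smul_def, Matrix.mulVec_smul, ← Units.smul_def, hj, smul_smul,
      Int.units_mul_self, one_smul] at h3
    have := c.strictMono_f.injective (congrArg (onInt f) h3)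
    lia
  refine ⟨⟨ε', by rw [← hjn]; exact hj⟩, ?_⟩
  rw [← h2, F.onInt_mulVec, F.onInt_mulVec]
  ring

/-! ### Periods and conjugacy -/

lemma periodic_shift_iff {s t : ℤ → ℕ} {j : ℤ} (hst : ∀ i, t i = s (i + j)) (p : ℤ) :
    Function.Periodic t p ↔ Function.Periodic s p := by
  constructor <;> intro hp i
  · have := hp (i - j)
    rw [hst, hst, sub_add_cancel, show i - j + p + j = i + p by ring] at this
    exact this
  · rw [hst, hst, ← hp (i + j)]
    congr 1; ring

lemma periodic_reverse_iff (s : ℤ → ℕ) (p : ℤ) :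
    Function.Periodic (fun i => s (-i - 2)) p ↔ Function.Periodic s p := by
  constructor <;> intro hp i
  · have := hp (-i - 2 - p)
    simp only at this
    rw [show -(-i - 2 - p + p) - 2 = i by ring, show -(-i - 2 - p) - 2 = i + p by ring] at this
    exact this.symm
  · have := hp (-(i + p) - 2)
    rw [show -(i + p) - 2 + p = -i - 2 by ring] at this
    exact this.symm

/-- All LLS sequences of `M` have the periods of the coefficients of its chain. -/
lemma IsEigenFrame.periodic_iff {M : GL (Fin 2) ℤ} {f h : (Fin 2 → ℝ) →ₗ[ℝ] ℝ} {x y : ℝ}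
    (F : IsEigenFrame M f h x y) {v : ℤ → Fin 2 → ℤ} {s t : ℤ → ℕ}
    (c : IsChain (onInt f) (onInt h) v s) (ht : IsLLSSequence M t) (p : ℤ) :
    Function.Periodic t p ↔ Function.Periodic s p := by
  obtain ⟨A, hA, hAt⟩ := ht
  rcases F.exists_chain_of_isSailOf hA hAt with ⟨w, -, d, -⟩ | ⟨w, -, d, -⟩
  · obtain ⟨j, -, hj⟩ := c.exists_shift d
    exact periodic_shift_iff hj p
  · obtain ⟨w', d'⟩ := d.exists_reverse
    obtain ⟨j, -, hj⟩ := c.exists_shift d'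
    rw [← periodic_reverse_iff t]
    exact periodic_shift_iff hj p

lemma block_congr {s : ℤ → ℕ} {m : ℤ} (hs : Function.Periodic s m) {i j : ℤ} {q : ℤ}
    (hij : j = i + q * m) (n : ℕ) : block s j n = block s i n := by
  refine List.map_congr_left fun r _ => ?_
  have := hs.int_mul q (i + r)
  simp only [Int.cast_id] at this
  rw [← this, hij]
  congr 1; ring

lemma periodic_of_block_eq {s : ℤ → ℕ} {n : ℕ} (hn : 0 < n) (hs : Function.Periodic s (n : ℤ))
    {i j : ℤ} (hij : block s i n = block s j n) : Function.Periodic s (j - i) := by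
  have hall : ∀ r : ℤ, s (i + r) = s (j + r) := fun r => by
    have h0 := Int.emod_nonneg r (show (n : ℤ) ≠ 0 by lia)
    have h1 := Int.emod_lt_of_pos r (show (0 : ℤ) < n by lia)
    have h2 := Int.mul_ediv_add_emod r n
    obtain ⟨u, hu⟩ := Int.eq_ofNat_of_zero_le h0
    have h3 := getElem_block s i n u (by rw [length_block]; lia)
    simp only [hij] at h3
    rw [getElem_block] at h3
    have h4 := hs.int_mul (r / n) (i + u)
    have h5 := hs.int_mul (r / n) (j + u)
    simp only [Int.cast_id] at h4 h5
    rw [show i + r = i + u + r / n * n by rw [← hu]; linarith,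
      show j + r = j + u + r / n * n by rw [← hu]; linarith, h4, h5, h3]
  intro r
  have := hall (r - i)
  rw [show i + (r - i) = r by ring, show j + (r - i) = r + (j - i) by ring] at this
  exact this.symm

lemma isPGLConj_iff {M g : GL (Fin 2) ℤ} :
    IsPGLConj M g ↔ ∃ (c : GL (Fin 2) ℤ) (ε : ℤˣ), M.val * c.val = ε • (c.val * g.val) := by
  have hscalar : ∀ u : ℤˣ, (Matrix.GeneralLinearGroup.scalar (Fin 2) u).val =
      u • (1 : Matrix (Fin 2) (Fin 2) ℤ) := fun u => by
    rw [Matrix.GeneralLinearGroup.coe_scalar, Units.smul_def, Matrix.scalar_apply,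
      ← Matrix.smul_one_eq_diagonal]
  constructor
  · intro hconj
    obtain ⟨c', hc'⟩ := isConj_iff.mp hconj
    obtain ⟨c, rfl⟩ := Matrix.ProjGenLinGroup.mk_surjective c'
    rw [← map_inv, ← map_mul, ← map_mul, Matrix.ProjGenLinGroup.mk_eq_mk_iff] at hc'
    obtain ⟨u, hu⟩ := hc'
    refine ⟨c⁻¹, u, ?_⟩
    have h1 : (c⁻¹ * g).val = (M * c⁻¹).val * (u • (1 : Matrix (Fin 2) (Fin 2) ℤ)) := by
      rw [← hu, ← hscalar, ← Units.val_mul]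
      congr 1; group
    rw [mul_smul_comm, mul_one] at h1
    rw [← Units.val_mul, ← Units.val_mul, h1, smul_smul, Int.units_mul_self, one_smul]
  · rintro ⟨c, ε, hc⟩
    refine isConj_iff.mpr ⟨Matrix.ProjGenLinGroup.mk c⁻¹, ?_⟩
    rw [← map_inv, ← map_mul, ← map_mul, Matrix.ProjGenLinGroup.mk_eq_mk_iff]
    refine ⟨ε, ?_⟩
    have h1 : M * c = c * g * Matrix.GeneralLinearGroup.scalar (Fin 2) ε := by
      apply Units.ext
      rw [Units.val_mul, hc, Units.val_mul, Units.val_mul, hscalar, mul_smul_comm, mul_one]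
    have h2 : Matrix.GeneralLinearGroup.scalar (Fin 2) ε *
        Matrix.GeneralLinearGroup.scalar (Fin 2) ε = 1 := by
      rw [← map_mul, Int.units_mul_self, map_one]
    rw [inv_inv, mul_assoc c⁻¹, h1, mul_assoc, mul_assoc, mul_assoc, h2]
    group

/-- If `± M` shifts a chain by `n`, then in the basis formed by two neighbours it is the product
belonging to the block of the `n` following coefficients. -/
lemma IsChain.exists_conj {M : GL (Fin 2) ℤ} {f h : (Fin 2 → ℤ) →+ ℝ} {v : ℤ → Fin 2 → ℤ}
    {s : ℤ → ℕ} (c : IsChain f h v s) {ε : ℤˣ} {n : ℕ}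
    (hv : ∀ i, M.val *ᵥ v i = ε • v (i + n)) (i : ℤ) :
    ∃ p g : GL (Fin 2) ℤ, g.val = contMatrix (block s i n) ∧
      M.val * p.val = ε • (p.val * g.val) := by
  have hu : IsUnit (colMatrix (v i) (v (i + 1))) := by
    rw [Matrix.isUnit_iff_isUnit_det, det_colMatrix]
    exact c.isUnit_intDet i
  obtain ⟨p, hp⟩ := hu
  have hblock := eq_mul_contMatrix_block (P := fun i => colMatrix (v i) (v (i + 1)))
    c.colMatrix_succ i n
  have hM : M.val * p.val = ε • (p.val * contMatrix (block s i n)) := by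
    rw [hp, ← hblock, mul_colMatrix, hv, hv, unit_smul_colMatrix,
      show i + 1 + (n : ℤ) = i + n + 1 by ring]
  have hg : IsUnit (contMatrix (block s i n)) := by
    refine List.prod_isUnit fun m hm => ?_
    obtain ⟨a, -, rfl⟩ := List.mem_map.mp hm
    exact (elemGL a).isUnit
  obtain ⟨g, hg⟩ := hg
  exact ⟨p, g, hg, by rw [hg]; exact hM⟩

end GaussReduction

/-- Let `M` be a `GL(2,ℤ)` matrix with real irrational eigenvalues, `l = (a_1,…,a_n)` an LLS
period of `M`, and `m` the minimal period length of the LLS sequence.  The reduced matrices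
that are `PGL(2,ℤ)`-conjugate to `M` are exactly the matrices `M_{a_{1+k},…,a_{n+k}}` (indices
modulo `n`) for `k = 1,…,m`, and these `m` matrices are pairwise distinct. -/
theorem mainTheorem1 (M : GL (Fin 2) ℤ) (hM : GaussReduction.HasRealIrrationalEigenvalues M)
    (l : List ℕ) (hl : GaussReduction.IsLLSPeriod M l)
    (m : ℕ) (hm : GaussReduction.IsMinimalLLSPeriodLength M m) :
    {N : Matrix (Fin 2) (Fin 2) ℤ | GaussReduction.IsReduced N ∧
        ∃ g : GL (Fin 2) ℤ, (g : Matrix (Fin 2) (Fin 2) ℤ) = N ∧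
          GaussReduction.IsPGLConj M g} =
      (fun k : ℕ => GaussReduction.contMatrix (l.rotate k)) '' Set.Icc 1 m ∧
    Set.InjOn (fun k : ℕ => GaussReduction.contMatrix (l.rotate k)) (Set.Icc 1 m) := by
  open GaussReduction in
  obtain ⟨f, h, x, y, F, hxy⟩ := hM.exists_frame
  obtain ⟨A, s, hA, hs, hshift, hper, j, hj⟩ := hl
  obtain ⟨t, ht, hmin⟩ := hm
  have hlb : l = block s j l.length := eq_block_iff.mpr hj
  set n := l.length
  -- The direction of the period excludes chains along which the contracted coordinate increases.
  obtain ⟨v, ε, c, hv, hx2⟩ : ∃ (v : ℤ → Fin 2 → ℤ) (ε : ℤˣ), IsChain (onInt f) (onInt h) v s ∧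
      (∀ i, M.val *ᵥ v i = ε • v (i + n)) ∧ x ^ 2 * onInt f (v 0) = onInt f (v (2 * n)) := by
    rcases F.exists_chain_of_isSailOf hA hs with ⟨v, ε, c, hv⟩ | ⟨v, ε, c, hv⟩
    · obtain ⟨⟨ε', hε'⟩, h2⟩ := F.shift_eq c hv hshift
      exact ⟨v, ε', c, hε', h2⟩
    · exfalso
      obtain ⟨-, h2⟩ := F.swap.shift_eq c hv hshift
      have h3 : onInt h (v 0) ≤ onInt h (v (2 * n)) :=
        c.strictMono_f.monotone (show (0 : ℤ) ≤ 2 * n by lia)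
      have h4 := c.f_pos 0
      have h5 : y ^ 2 < x ^ 2 := sq_lt_sq.mpr hxy
      have h6 : x ^ 2 * y ^ 2 = 1 := by rw [← mul_pow]; exact F.mul_sq
      have h7 : 1 ≤ y ^ 2 := by
        rw [← h2] at h3
        by_contra! h8
        nlinarith
      nlinarith
  have hn : 0 < n := by
    rcases Nat.eq_zero_or_pos n with h0 | h0
    · exfalso
      rw [h0, Nat.cast_zero, mul_zero] at hx2
      exact F.x_sq_ne_one (mul_right_cancel₀ (c.f_pos 0).ne' (by rw [hx2, one_mul]))
    · exact h0
  have hleast : IsLeast {p : ℕ | 0 < p ∧ Function.Periodic s (p : ℤ)} m := by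
    simpa only [F.periodic_iff c ht] using hmin
  obtain ⟨⟨hm0, hmper⟩, hmle⟩ := hleast
  have hrot : ∀ k : ℕ, l.rotate k = block s (j + k) n := fun k => by
    rw [hlb, rotate_block hper]
  have hblock_ne : ∀ i, block s i n ≠ [] := fun i => by
    rw [← List.length_pos_iff, length_block]; exact hn
  have hblock_pos : ∀ i, ∀ a ∈ block s i n, 0 < a := fun i a ha => by
    obtain ⟨r, -, rfl⟩ := List.mem_map.mp ha
    exact c.pos _
  constructor
  · ext N
    constructor
    · rintro ⟨⟨l', hl', hpos, rfl⟩, g, hg, hconj⟩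
      obtain ⟨p, δ, hp⟩ := isPGLConj_iff.mp hconj
      rw [hg] at hp
      obtain ⟨i, hi, -⟩ := F.eq_block_of_reduced hxy c hv hl' hpos p δ hp
      have h0 := Int.emod_nonneg (i - j - 1) (show (m : ℤ) ≠ 0 by lia)
      have h1 := Int.emod_lt_of_pos (i - j - 1) (show (0 : ℤ) < m by lia)
      have h2 := Int.mul_ediv_add_emod (i - j - 1) m
      obtain ⟨r, hr⟩ := Int.eq_ofNat_of_zero_le h0
      refine ⟨r + 1, ⟨by lia, by lia⟩, ?_⟩
      have h3 : i = j + ((r + 1 : ℕ) : ℤ) + (i - j - 1) / m * m := by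
        push_cast
        rw [← hr]
        linarith
      simp only
      rw [hrot, hi, block_congr hmper h3]
    · rintro ⟨k, -, rfl⟩
      simp only [hrot]
      obtain ⟨p, g, hg, hp⟩ := c.exists_conj hv (j + k)
      exact ⟨⟨_, hblock_ne _, hblock_pos _, rfl⟩, g, hg, isPGLConj_iff.mpr ⟨p, ε, hp⟩⟩
  · -- One conjugating matrix determines the block, so equal products come from equal blocks.
    have hinj : ∀ i i', contMatrix (block s i n) = contMatrix (block s i' n) →
        block s i n = block s i' n := fun i i' heq => by
      obtain ⟨p, g, hg, hp⟩ := c.exists_conj hv i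
      rw [hg] at hp
      obtain ⟨u, hu, hu'⟩ := F.eq_block_of_reduced hxy c hv (hblock_ne i) (hblock_pos i) p ε hp
      rw [heq] at hp
      obtain ⟨w, hw, hw'⟩ := F.eq_block_of_reduced hxy c hv (hblock_ne i') (hblock_pos i') p ε hp
      rw [← hw', abs_of_pos (c.f_pos _), abs_of_pos (c.f_pos _)] at hu'
      rw [hu, hw, c.strictMono_f.injective hu']
    have hlt : ∀ k k' : ℕ, 1 ≤ k → k' ≤ m → contMatrix (l.rotate k) = contMatrix (l.rotate k') →
        ¬ k < k' := fun k k' hk hk' heq hlt => by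
      rw [hrot, hrot] at heq
      have h1 := periodic_of_block_eq hn hper (hinj _ _ heq)
      have h2 : m ≤ k' - k := hmle ⟨by lia, by
        rwa [show (((k' - k : ℕ)) : ℤ) = j + k' - (j + k) by lia]⟩
      lia
    intro k hk k' hk' heq
    have h1 := hlt k k' hk.1 hk'.2 heq
    have h2 := hlt k' k hk'.1 hk.2 heq.symm
    lia
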